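/- Let $A$ be a unital $C^*$-algebra and let $B$ be a von Neumann algebra acting on a complex Hilbert space $G$. A Hilbert $A$-$B$-module is a right $B$-module $E$ with a $B$-valued inner product (linear in the second variable), complete in the norm $\|x\|=\|\langle x,x\rangle\|^{1/2}$, on which $A$ acts from the left by a unital $*$-representation by adjointable operators. Let $E\odot G$ be the Hilbert space obtained from the algebraic tensor product $E\otimes G$ by separation and completion for the semi-inner product $\langle x\otimes g,y\otimes h\rangle=\langle g,\langle x,y\rangle h\rangle$, and regard $E$ as a space of bounded operators $G\to E\odot G$ through $x\mapsto L_x$, $L_xg=x\odot g$. The module $E$ is a von Neumann $B$-module if it is closed in the strong operator topology under this identification. No normality of the left action of $A$ is required. For $i=1,2$ let $\varphi_i:A\to B$ be a completely positive map, let $F_i$ be a Hilbert $A$-$B$-module which is a von Neumann $B$-module, and let $y_i\in F_i$ be such that $(F_i,y_i)$ is a GNS-representation of $\varphi_i$, i.e. $\varphi_i(a)=\langle y_i,ay_i\rangle$ for all $a\in A$. Let $\psi:A\to B$ be a linear map, put $\psi^*(a)=\psi(a^*)^*$, and suppose that the block map $$\Phi=\begin{pmatrix}\varphi_1&\psi\\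 \psi^*&\varphi_2\end{pmatrix}:M_2(A)\to M_2(B),\qquad \begin{pmatrix}a_{11}&a_{12}\\a_{21}&a_{22}\end{pmatrix}\mapsto\begin{pmatrix}\varphi_1(a_{11})&\psi(a_{12})\\ \psi^*(a_{21})&\varphi_2(a_{22})\end{pmatrix}$$ is completely positive. Then there is an adjointable contraction $T:F_2\to F_1$ which is bilinear (that is, $T(axb)=a\,T(x)\,b$ for $a\in A$, $x\in F_2$, $b\in B$) and satisfies $$\psi(a)=\langle y_1,T(ay_2)\rangle\qquad\text{for all }a\in A.$$ If moreover both $(F_i,y_i)$ are minimal, i.e. $F_i$ is the strong operator closure of the linear span of $Ay_iB$, then such a $T$ is unique. -/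

import Mathlib

open scoped TensorProduct InnerProductSpace CStarAlgebra
open MulOpposite

section VonNeumannAlgebra

variable {G : Type*} [NormedAddCommGroup G] [InnerProductSpace ℂ G] [CompleteSpace G]

instance VonNeumannAlgebra.instSMulMemClass :
    SMulMemClass (VonNeumannAlgebra G) ℂ (G →L[ℂ] G) where
  smul_mem {s} r _ hx := s.toStarSubalgebra.smul_mem hx r

/-- A von Neumann algebra is norm closed, hence a C⋆-algebra (`StarSubalgebra.cstarAlgebra`). -/
instance VonNeumannAlgebra.instIsClosed (B : VonNeumannAlgebra G) :
    IsClosed (B : Set (G →L[ℂ] G)) := by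
  rw [← B.centralizer_centralizer]
  exact Set.isClosed_centralizer _

/-- The order inherited from the operators on `G` is the C⋆-algebra order. -/
instance VonNeumannAlgebra.instStarOrderedRing (B : VonNeumannAlgebra G) :
    StarOrderedRing B := by
  refine StarOrderedRing.of_nonneg_iff' (fun {x y} hxy z => ?_) (fun x => ⟨fun hx => ?_, ?_⟩)
  · exact add_le_add_right (α := G →L[ℂ] G) hxy z
  · have hx' : (0 : G →L[ℂ] G) ≤ x := hx
    have hs : CFC.sqrt (x : G →L[ℂ] G) ∈ B := by
      rw [← SetLike.mem_coe, ← B.centralizer_centralizer]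
      intro y hy
      have hc : Commute (x : G →L[ℂ] G) y := hy x x.2
      exact (hc.cfcₙ_nnreal NNReal.sqrt).symm.eq
    refine ⟨⟨_, hs⟩, Subtype.ext ?_⟩
    have h2 : star (CFC.sqrt (x : G →L[ℂ] G)) = CFC.sqrt (x : G →L[ℂ] G) :=
      (CFC.sqrt_nonneg (x : G →L[ℂ] G)).isSelfAdjoint.star_eq
    change (x : G →L[ℂ] G) = star (CFC.sqrt (x : G →L[ℂ] G)) * CFC.sqrt (x : G →L[ℂ] G)
    rw [h2, CFC.sqrt_mul_sqrt_self _ hx']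
  · rintro ⟨s, rfl⟩
    exact star_mul_self_nonneg (s : G →L[ℂ] G)

/-- The identity representation of a von Neumann algebra on its Hilbert space. -/
noncomputable def VonNeumannAlgebra.inclusion (B : VonNeumannAlgebra G) : B →⋆ₐ[ℂ] (G →L[ℂ] G) :=
  B.toStarSubalgebra.subtype

end VonNeumannAlgebra

section HilbertModule

variable {B E : Type*} [CStarAlgebra B] [PartialOrder B]
  [NormedAddCommGroup E] [NormedSpace ℂ E] [Module Bᵐᵒᵖ E] [CStarModule Bᵐᵒᵖ E]

variable (B) in
/-- The `B`-valued inner product of a right Hilbert `B`-module `E`, linear in the second variable.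
A right `B`-module is a left `Bᵐᵒᵖ`-module (`x b` is written `op b • x`), and Mathlib's
`CStarModule Bᵐᵒᵖ E` carries the same inner product regarded as an element of `Bᵐᵒᵖ`. -/
def moduleInner (x y : E) : B := unop (inner Bᵐᵒᵖ x y)

lemma moduleInner_add_right (x y z : E) :
    moduleInner B x (y + z) = moduleInner B x y + moduleInner B x z := by
  simp [moduleInner]

lemma moduleInner_smul_right (c : ℂ) (x y : E) :
    moduleInner B x (c • y) = c • moduleInner B x y := by
  simp [moduleInner]

/-- `⟨x, y b⟩ = ⟨x, y⟩ b`. -/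
lemma moduleInner_op_smul_right (b : B) (x y : E) :
    moduleInner B x (op b • y) = moduleInner B x y * b := by
  simp [moduleInner]

lemma star_moduleInner (x y : E) : star (moduleInner B x y) = moduleInner B y x := by
  rw [moduleInner, ← unop_star, CStarModule.star_inner]; rfl

lemma moduleInner_add_left (x y z : E) :
    moduleInner B (x + y) z = moduleInner B x z + moduleInner B y z := by
  simp [moduleInner]

lemma moduleInner_smul_left (c : ℂ) (x y : E) :
    moduleInner B (c • x) y = star c • moduleInner B x y := by
  simp [moduleInner]

/-- `⟨x b, y⟩ = b⋆ ⟨x, y⟩`. -/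
lemma moduleInner_op_smul_left (b : B) (x y : E) :
    moduleInner B (op b • x) y = star b * moduleInner B x y := by
  simp [moduleInner]

lemma moduleInner_self_nonneg (x : E) : 0 ≤ moduleInner B x x :=
  unop_nonneg.2 CStarModule.inner_self_nonneg

lemma moduleInner_self (x : E) : moduleInner B x x = 0 ↔ x = 0 := by
  rw [moduleInner, unop_eq_zero_iff, CStarModule.inner_self]

lemma norm_sq_eq_moduleInner (x : E) : ‖x‖ ^ 2 = ‖moduleInner B x x‖ :=
  CStarModule.norm_sq_eq Bᵐᵒᵖ

end HilbertModule

section Gram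

variable {B E : Type*} [CStarAlgebra B] [PartialOrder B]
  [NormedAddCommGroup E] [NormedSpace ℂ E] [Module Bᵐᵒᵖ E] [CStarModule Bᵐᵒᵖ E]

lemma moduleInner_sum_left {ι : Type*} (s : Finset ι) (x : ι → E) (y : E) :
    moduleInner B (∑ i ∈ s, x i) y = ∑ i ∈ s, moduleInner B (x i) y := by
  simp [moduleInner]

lemma moduleInner_sum_right {ι : Type*} (s : Finset ι) (x : E) (y : ι → E) :
    moduleInner B x (∑ i ∈ s, y i) = ∑ i ∈ s, moduleInner B x (y i) := by
  simp [moduleInner]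

lemma CStarAlgebra.exists_cube_of_isSelfAdjoint {M : Type*} [CStarAlgebra M] [PartialOrder M]
    [StarOrderedRing M] {X : M} (hX : IsSelfAdjoint X) :
    ∃ N D : M, star N = N ∧ N * X * N = -(star D * D) ∧ (D = 0 → 0 ≤ X) := by
  have hN0 : 0 ≤ X⁻ := CFC.negPart_nonneg X
  have hNsa : star X⁻ = X⁻ := hN0.isSelfAdjoint.star_eq
  have hcube : 0 ≤ X⁻ ^ 3 := by
    have := star_left_conjugate_nonneg hN0 X⁻
    rwa [hNsa, ← pow_two, ← pow_succ] at this
  obtain ⟨D, hD⟩ := CStarAlgebra.nonneg_iff_eq_star_mul_self.1 hcube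
  have h1 : X⁻ * X * X⁻ = -(X⁻ ^ 3) :=
    calc X⁻ * X * X⁻ = X⁻ * (X⁺ - X⁻) * X⁻ :=
          congr(X⁻ * $(CFC.posPart_sub_negPart X hX) * X⁻).symm
      _ = -(X⁻ ^ 3) := by simp [mul_sub, pow_succ]
  refine ⟨X⁻, D, hNsa, by rw [h1, hD], fun hD0 => ?_⟩
  have hN3 : X⁻ ^ 3 = 0 := by rw [hD, hD0]; simp
  have h4 : star (X⁻ * X⁻) * (X⁻ * X⁻) = 0 := by
    rw [star_mul, hNsa]
    calc X⁻ * X⁻ * (X⁻ * X⁻) = X⁻ ^ 3 * X⁻ := by noncomm_ring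
      _ = 0 := by rw [hN3, zero_mul]
  have h5 : star X⁻ * X⁻ = 0 := by rw [hNsa]; exact (CStarRing.star_mul_self_eq_zero_iff _).1 h4
  have h6 : X⁻ = 0 := (CStarRing.star_mul_self_eq_zero_iff _).1 h5
  rw [← CFC.posPart_sub_negPart X hX, h6, sub_zero]
  exact CFC.posPart_nonneg X

lemma CStarAlgebra.exists_star_mul_self_of_nonneg {M : Type*} [CStarAlgebra M] [PartialOrder M]
    [StarOrderedRing M] {X : M} (hX : 0 ≤ X) : ∃ D : M, X = star D * D :=
  CStarAlgebra.nonneg_iff_eq_star_mul_self.1 hX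

/-- The Gram matrix of finitely many vectors of a Hilbert module is positive, hence of the form
`D⋆ D`. -/
lemma exists_gram_eq [StarOrderedRing B] {n : ℕ} (x : Fin n → E) :
    ∃ D : Fin n → Fin n → B,
      ∀ i j, moduleInner B (x i) (x j) = ∑ k, star (D k i) * D k j := by
  let X : CStarMatrix (Fin n) (Fin n) B := fun i j => moduleInner B (x i) (x j)
  have hsa : IsSelfAdjoint X := by
    refine CStarMatrix.ext fun i j => ?_
    rw [CStarMatrix.star_apply]
    exact star_moduleInner _ _
  obtain ⟨N, D, hN, hD, hpos⟩ := CStarAlgebra.exists_cube_of_isSelfAdjoint hsa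
  have hdiag (k : Fin n) : 0 ≤ (N * X * N) k k := by
    have hst : ∀ i, N k i = star (N i k) := fun i => by
      rw [← CStarMatrix.star_apply, hN]
    have : (N * X * N) k k = moduleInner B (∑ i, op (N i k) • x i) (∑ i, op (N i k) • x i) := by
      have hm : (N * X * N) k k =
          ∑ j, (∑ i, N k i * moduleInner B (x i) (x j)) * N j k := rfl
      simp only [hm, moduleInner_sum_left, moduleInner_sum_right,
        moduleInner_op_smul_left, moduleInner_op_smul_right, hst, Finset.sum_mul, mul_assoc]
    rw [this]
    exact moduleInner_self_nonneg _
  have hX : 0 ≤ X := by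
    refine hpos (CStarMatrix.ext fun i k => ?_)
    have h2 : (N * X * N) k k = -∑ j, star (D j k) * D j k := by
      rw [hD, CStarMatrix.neg_apply, CStarMatrix.mul_apply]
      simp only [CStarMatrix.star_apply]
    have h3 : ∑ j, star (D j k) * D j k ≤ 0 := by
      have := hdiag k
      rwa [h2, neg_nonneg] at this
    have h4 := (Finset.sum_eq_zero_iff_of_nonneg
      (fun j _ => star_mul_self_nonneg (D j k))).1
      (le_antisymm h3 (Finset.sum_nonneg fun j _ => star_mul_self_nonneg (D j k))) i (by simp)
    exact (CStarRing.star_mul_self_eq_zero_iff _).1 h4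
  obtain ⟨C, hC⟩ := CStarAlgebra.exists_star_mul_self_of_nonneg hX
  refine ⟨C, fun i j => ?_⟩
  have : X i j = (star C * C) i j := by rw [hC]
  rw [CStarMatrix.mul_apply] at this
  simpa only [CStarMatrix.star_apply] using this

end Gram

section InteriorTensor

variable {B E G : Type*} [CStarAlgebra B] [PartialOrder B] [StarOrderedRing B]
  [NormedAddCommGroup E] [NormedSpace ℂ E] [Module Bᵐᵒᵖ E] [CStarModule Bᵐᵒᵖ E]
  [NormedAddCommGroup G] [InnerProductSpace ℂ G] [CompleteSpace G]

/-- The semi-inner product `⟨x ⊗ g, y ⊗ h⟩ = ⟨g, π(⟨x, y⟩) h⟩` on the algebraic tensor product. -/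
noncomputable def preInteriorForm (π : B →⋆ₐ[ℂ] (G →L[ℂ] G)) (E : Type*) [NormedAddCommGroup E]
    [NormedSpace ℂ E] [Module Bᵐᵒᵖ E] [CStarModule Bᵐᵒᵖ E] :
    E ⊗[ℂ] G →ₗ⋆[ℂ] E ⊗[ℂ] G →ₗ[ℂ] ℂ :=
  TensorProduct.lift <| LinearMap.mk₂'ₛₗ (starRingEnd ℂ) (starRingEnd ℂ)
    (fun (x : E) (g : G) => TensorProduct.lift <| LinearMap.mk₂ ℂ
      (fun (y : E) (h : G) => ⟪g, π (moduleInner B x y) h⟫_ℂ)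
      (by intros; simp [moduleInner_add_right])
      (by intros; simp [moduleInner_smul_right])
      (by intros; simp)
      (by intros; simp))
    (by intros; ext; simp [moduleInner_add_left])
    (by intros; ext; simp [moduleInner_smul_left])
    (by intros; ext; simp)
    (by intros; ext; simp [mul_comm])

@[simp]
lemma preInteriorForm_tmul (π : B →⋆ₐ[ℂ] (G →L[ℂ] G)) (x y : E) (g h : G) :
    preInteriorForm π E (x ⊗ₜ g) (y ⊗ₜ h) = ⟪g, π (moduleInner B x y) h⟫_ℂ := by
  simp [preInteriorForm]

lemma preInteriorForm_conj (π : B →⋆ₐ[ℂ] (G →L[ℂ] G)) (z w : E ⊗[ℂ] G) :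
    starRingEnd ℂ (preInteriorForm π E w z) = preInteriorForm π E z w := by
  induction z with
  | zero => simp
  | add z₁ z₂ h₁ h₂ => simp [h₁, h₂]
  | tmul x g =>
    induction w with
    | zero => simp
    | add w₁ w₂ h₁ h₂ => simp [h₁, h₂]
    | tmul y h =>
      rw [preInteriorForm_tmul, preInteriorForm_tmul, inner_conj_symm,
        ← ContinuousLinearMap.adjoint_inner_right, ← ContinuousLinearMap.star_eq_adjoint,
        ← map_star, star_moduleInner]

open scoped ComplexOrder in
lemma preInteriorForm_self_nonneg (π : B →⋆ₐ[ℂ] (G →L[ℂ] G)) (z : E ⊗[ℂ] G) :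
    0 ≤ preInteriorForm π E z z := by
  obtain ⟨n, x, g, rfl⟩ : ∃ (n : ℕ) (x : Fin n → E) (g : Fin n → G), z = ∑ i, x i ⊗ₜ g i := by
    obtain ⟨S, hS⟩ := TensorProduct.exists_finset z
    refine ⟨S.card, fun i => (S.equivFin.symm i).1.1, fun i => (S.equivFin.symm i).1.2, ?_⟩
    rw [hS, ← Finset.sum_coe_sort, ← S.equivFin.symm.sum_comp]
  obtain ⟨D, hD⟩ := exists_gram_eq (B := B) x
  have key : preInteriorForm π E (∑ i, x i ⊗ₜ g i) (∑ i, x i ⊗ₜ g i) =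
      ∑ k, ⟪∑ i, π (D k i) (g i), ∑ i, π (D k i) (g i)⟫_ℂ := by
    simp only [map_sum, LinearMap.sum_apply, preInteriorForm_tmul, hD, map_mul, map_star,
      sum_apply, mul_apply_eq_comp, sum_inner, inner_sum,
      ContinuousLinearMap.star_eq_adjoint, ContinuousLinearMap.adjoint_inner_right]
    have h : ∀ i : Fin n, ∑ j, ∑ k, ⟪π (D k i) (g i), π (D k j) (g j)⟫_ℂ =
        ∑ k, ∑ j, ⟪π (D k i) (g i), π (D k j) (g j)⟫_ℂ := fun i => Finset.sum_comm
    rw [Finset.sum_comm]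
    simp only [h]
    rw [Finset.sum_comm]
    exact Finset.sum_congr rfl fun _ _ => Finset.sum_comm
  rw [key]
  exact Finset.sum_nonneg fun k _ => RCLike.nonneg_iff.2
    ⟨inner_self_nonneg, inner_self_im _⟩

/-- The algebraic tensor product `E ⊗ G` with the semi-inner product induced by `π`. -/
@[nolint unusedArguments]
def PreInteriorTensor (_π : B →⋆ₐ[ℂ] (G →L[ℂ] G)) (E : Type*) [NormedAddCommGroup E]
    [NormedSpace ℂ E] : Type _ := E ⊗[ℂ] G

instance (π : B →⋆ₐ[ℂ] (G →L[ℂ] G)) : AddCommGroup (PreInteriorTensor π E) :=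
  inferInstanceAs (AddCommGroup (E ⊗[ℂ] G))

instance (π : B →⋆ₐ[ℂ] (G →L[ℂ] G)) : Module ℂ (PreInteriorTensor π E) :=
  inferInstanceAs (Module ℂ (E ⊗[ℂ] G))

/-- The identity map from `E ⊗ G` to its type synonym. -/
def toPreInteriorTensor (π : B →⋆ₐ[ℂ] (G →L[ℂ] G)) (E : Type*) [NormedAddCommGroup E]
    [NormedSpace ℂ E] : E ⊗[ℂ] G ≃ₗ[ℂ] PreInteriorTensor π E := LinearEquiv.refl ℂ _

open scoped ComplexOrder in
/-- The semi-inner product on `E ⊗ G`. -/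
noncomputable abbrev preInteriorCore (π : B →⋆ₐ[ℂ] (G →L[ℂ] G)) (E : Type*)
    [NormedAddCommGroup E] [NormedSpace ℂ E] [Module Bᵐᵒᵖ E] [CStarModule Bᵐᵒᵖ E] :
    PreInnerProductSpace.Core ℂ (PreInteriorTensor π E) where
  inner z w := preInteriorForm π E ((toPreInteriorTensor π E).symm z)
    ((toPreInteriorTensor π E).symm w)
  conj_inner_symm _ _ := preInteriorForm_conj π _ _
  re_inner_nonneg _ := (RCLike.nonneg_iff.1 (preInteriorForm_self_nonneg π _)).1
  add_left _ _ _ := by simp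
  smul_left _ _ _ := by simp

noncomputable instance (π : B →⋆ₐ[ℂ] (G →L[ℂ] G)) :
    SeminormedAddCommGroup (PreInteriorTensor π E) :=
  InnerProductSpace.Core.toSeminormedAddCommGroup (c := preInteriorCore π E)

noncomputable instance (π : B →⋆ₐ[ℂ] (G →L[ℂ] G)) :
    InnerProductSpace ℂ (PreInteriorTensor π E) :=
  InnerProductSpace.ofCore (preInteriorCore π E)

lemma preInteriorTensor_inner (π : B →⋆ₐ[ℂ] (G →L[ℂ] G)) (z w : E ⊗[ℂ] G) :
    ⟪toPreInteriorTensor π E z, toPreInteriorTensor π E w⟫_ℂ = preInteriorForm π E z w := rfl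

/-- The interior tensor product `E ⊙ G` along the representation `π` of `B` on `G`: the Hausdorff
completion of `E ⊗ G` for the semi-inner product `⟨x ⊗ g, y ⊗ h⟩ = ⟨g, π(⟨x, y⟩) h⟩`. -/
abbrev InteriorTensor (π : B →⋆ₐ[ℂ] (G →L[ℂ] G)) (E : Type*) [NormedAddCommGroup E]
    [NormedSpace ℂ E] [Module Bᵐᵒᵖ E] [CStarModule Bᵐᵒᵖ E] : Type _ :=
  UniformSpace.Completion (PreInteriorTensor π E)

/-- The elementary tensor `x ⊙ g`. -/
noncomputable def interiorTmul (π : B →⋆ₐ[ℂ] (G →L[ℂ] G)) (x : E) (g : G) :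
    InteriorTensor π E :=
  ((toPreInteriorTensor π E (x ⊗ₜ g) : PreInteriorTensor π E) : InteriorTensor π E)

lemma inner_interiorTmul (π : B →⋆ₐ[ℂ] (G →L[ℂ] G)) (x y : E) (g h : G) :
    ⟪interiorTmul π x g, interiorTmul π y h⟫_ℂ = ⟪g, π (moduleInner B x y) h⟫_ℂ := by
  rw [interiorTmul, interiorTmul, UniformSpace.Completion.inner_coe, preInteriorTensor_inner,
    preInteriorForm_tmul]

lemma norm_interiorTmul_le (π : B →⋆ₐ[ℂ] (G →L[ℂ] G)) (x : E) (g : G) :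
    ‖interiorTmul π x g‖ ≤ ‖x‖ * ‖g‖ := by
  refine le_of_sq_le_sq ?_ (by positivity)
  have h1 : ‖interiorTmul π x g‖ ^ 2 = ‖⟪g, π (moduleInner B x x) g⟫_ℂ‖ := by
    rw [← inner_interiorTmul, inner_self_eq_norm_sq_to_K]
    simp
  rw [h1, mul_pow, norm_sq_eq_moduleInner (B := B) x]
  calc ‖⟪g, π (moduleInner B x x) g⟫_ℂ‖ ≤ ‖g‖ * ‖π (moduleInner B x x) g‖ := norm_inner_le_norm _ _
    _ ≤ ‖g‖ * (‖moduleInner B x x‖ * ‖g‖) := by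
      gcongr
      exact ((π (moduleInner B x x)).le_opNorm g).trans
        (mul_le_mul_of_nonneg_right (NonUnitalStarAlgHom.norm_apply_le π _) (norm_nonneg g))
    _ = ‖moduleInner B x x‖ * ‖g‖ ^ 2 := by ring

/-- The operator `L_x : G → E ⊙ G`, `L_x g = x ⊙ g`, as a linear function of `x ∈ E`. This is the
embedding through which `E` is regarded as a space of operators from `G` to `E ⊙ G`. -/
noncomputable def creation (π : B →⋆ₐ[ℂ] (G →L[ℂ] G)) (E : Type*) [NormedAddCommGroup E]
    [NormedSpace ℂ E] [Module Bᵐᵒᵖ E] [CStarModule Bᵐᵒᵖ E] :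
    E →ₗ[ℂ] (G →L[ℂ] InteriorTensor π E) where
  toFun x := LinearMap.mkContinuous
    { toFun := fun g => interiorTmul π x g
      map_add' := fun g h => by
        simp only [interiorTmul, TensorProduct.tmul_add, map_add, UniformSpace.Completion.coe_add]
      map_smul' := fun c g => by
        simp only [interiorTmul, TensorProduct.tmul_smul, map_smul,
          UniformSpace.Completion.coe_smul, RingHom.id_apply] }
    ‖x‖ (fun g => norm_interiorTmul_le π x g)
  map_add' x y := by
    ext g
    simp only [interiorTmul, TensorProduct.add_tmul, map_add]
    exact UniformSpace.Completion.coe_add _ _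
  map_smul' c x := by
    ext g
    simp [interiorTmul, ← TensorProduct.smul_tmul']

@[simp]
lemma creation_apply (π : B →⋆ₐ[ℂ] (G →L[ℂ] G)) (x : E) (g : G) :
    creation π E x g = interiorTmul π x g := rfl

/-- The image of a subset `S` of `E` in the operators from `G` to `E ⊙ G`, the latter with the
strong operator topology, that is, the topology of pointwise convergence on `G`. -/
def creationImage (π : B →⋆ₐ[ℂ] (G →L[ℂ] G)) (S : Set E) : Set (G →Lₚₜ[ℂ] InteriorTensor π E) :=
  (fun x => (creation π E x).toPointwiseConvergenceCLM ℂ (RingHom.id ℂ) G (InteriorTensor π E)) '' S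

end InteriorTensor

section VonNeumannModules

variable {G : Type*} [NormedAddCommGroup G] [InnerProductSpace ℂ G] [CompleteSpace G]

/-- A Hilbert module `E` over a von Neumann algebra `B` on `G` is a von Neumann `B`-module if it
is strongly closed as a space of operators from `G` to `E ⊙ G`. -/
def IsVonNeumannModule (B : VonNeumannAlgebra G) (E : Type*) [NormedAddCommGroup E]
    [NormedSpace ℂ E] [Module Bᵐᵒᵖ E] [CStarModule Bᵐᵒᵖ E] : Prop :=
  IsClosed (creationImage B.inclusion (Set.univ : Set E))

/-- Minimality of `(E, ξ)` over a von Neumann algebra: `E` is the strong closure of the linear span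
of `A ξ B`. -/
def IsMinimal (A : Type*) [CStarAlgebra A] (B : VonNeumannAlgebra G) {E : Type*}
    [NormedAddCommGroup E] [NormedSpace ℂ E] [Module Bᵐᵒᵖ E] [CStarModule Bᵐᵒᵖ E] [Module A E]
    (ξ : E) : Prop :=
  creationImage B.inclusion (Set.univ : Set E) ⊆
    closure (creationImage B.inclusion
      (Submodule.span ℂ {z : E | ∃ (a : A) (b : B), z = a • op b • ξ} : Set E))

end VonNeumannModules

section Bimodules

/-- A Hilbert `A`-`B`-module: a right Hilbert `B`-module `E`, complete in its norm, on which the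
unital C⋆-algebra `A` acts from the left by a unital (hence nondegenerate) ⋆-representation by
adjointable operators. That `1` acts as the identity is part of `Module A E`. -/
structure IsHilbertBimodule (A B E : Type*) [CStarAlgebra A] [CStarAlgebra B] [PartialOrder B]
    [NormedAddCommGroup E] [NormedSpace ℂ E] [Module Bᵐᵒᵖ E] [CStarModule Bᵐᵒᵖ E]
    [Module A E] : Prop where
  complete : CompleteSpace E
  smul_complex : ∀ (c : ℂ) (a : A) (x : E), (c • a) • x = c • (a • x)
  inner_smul : ∀ (a : A) (x y : E), moduleInner B (a • x) y = moduleInner B x (star a • y)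

/-- `(E, ξ)` is a GNS-representation of `φ : A → B`: `φ(a) = ⟨ξ, a ξ⟩` for all `a`. -/
def IsGNSRepresentation {A B E : Type*} [CStarAlgebra A] [CStarAlgebra B] [PartialOrder B]
    [NormedAddCommGroup E] [NormedSpace ℂ E] [Module Bᵐᵒᵖ E] [CStarModule Bᵐᵒᵖ E]
    [Module A E] (φ : A → B) (ξ : E) : Prop :=
  ∀ a : A, φ a = moduleInner B ξ (a • ξ)

/-- `T : E → F` is an adjointable `A`-`B`-bilinear contraction. -/
structure IsAdjointableBilinearContraction (A B : Type*) {E F : Type*} [CStarAlgebra A]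
    [CStarAlgebra B] [PartialOrder B]
    [NormedAddCommGroup E] [NormedSpace ℂ E] [Module Bᵐᵒᵖ E] [CStarModule Bᵐᵒᵖ E] [Module A E]
    [NormedAddCommGroup F] [NormedSpace ℂ F] [Module Bᵐᵒᵖ F] [CStarModule Bᵐᵒᵖ F] [Module A F]
    (T : E →L[ℂ] F) : Prop where
  adjointable : ∃ S : F → E, ∀ x y, moduleInner B (T x) y = moduleInner B x (S y)
  map_left : ∀ (a : A) (x : E), T (a • x) = a • T x
  map_right : ∀ (b : B) (x : E), T (op b • x) = op b • T x
  contraction : ‖T‖ ≤ 1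

end Bimodules

/-! The form `⟨a ⊗ g, a' ⊗ h⟩ = ⟨g, ψ(a⋆a') h⟩` on `A →₀ G` is the off-diagonal corner of the form
of `Φ`. Positivity of the latter gives a Cauchy–Schwarz inequality (`norm_stinespringForm_le`) whose
diagonal terms are, by the GNS property, the squared norms of the vectors `∑ a yᵢ ⊙ g` in `Fᵢ ⊙ G`.
Hence (`exists_contraction_of_norm_le`) there is a contraction `T : F₂ ⊙ G → F₁ ⊙ G` with `⟨a y₁ ⊙
g, T (a' y₂ ⊙ h)⟩ = ⟨g, ψ(a⋆a') h⟩`, which together with its adjoint vanishes off the closed spans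
of these vectors.

The main point is that `T` comes from a map of modules: each `T L_x` must lie in the strong closure
of `F₁`. For a finite family `u` in `G`, let `Qᵢ` be the projection onto the closure of `{(x ⊙
u_k)_k : x ∈ Fᵢ}` and `P` the one onto the closure of `{(b u_k)_k : b ∈ B}`. Then `Qᵢ L_x = L_x P`,
and `P` commutes with the amplified `B`. As the coefficients `ψ(a⋆a')` of `T` lie in `B`, it follows
that `T Q₂ = Q₁ T`, and so `T L_x u` is a limit of vectors `L_z u` with `z ∈ F₁`. This is the
argument of the double commutant theorem, and normality plays no role. Strong closedness of `F₁`
yields the map, that of `F₂` its adjoint.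

Left linearity and `T Q₂ = Q₁ T` are two instances of one intertwining criterion,
`comp_eq_comp_of_inner_eq`. For uniqueness, `ψ` determines all coefficients of `T` between the
generators, and minimality is used once for the adjoint and once for `T`. -/

section HilbertSpace

/-! ### Contractions from bounded forms, and intertwining criteria. -/

variable {H₁ H₂ : Type*} [NormedAddCommGroup H₁] [InnerProductSpace ℂ H₁] [CompleteSpace H₁]
  [NormedAddCommGroup H₂] [InnerProductSpace ℂ H₂] [CompleteSpace H₂]

/-- A sesquilinear form dominated by the product of two seminorms `‖Λ₁ v‖` and `‖Λ₂ w‖` is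
implemented by a contraction that lives on the closures of the ranges of `Λ₁` and `Λ₂`. -/
lemma exists_contraction_of_norm_le {V₁ V₂ : Type*} [AddCommGroup V₁] [Module ℂ V₁]
    [AddCommGroup V₂] [Module ℂ V₂] (Λ₁ : V₁ →ₗ[ℂ] H₁) (Λ₂ : V₂ →ₗ[ℂ] H₂)
    (S : V₁ →ₗ⋆[ℂ] V₂ →ₗ[ℂ] ℂ) (hS : ∀ v w, ‖S v w‖ ≤ ‖Λ₁ v‖ * ‖Λ₂ w‖) :
    ∃ T : H₂ →L[ℂ] H₁, ‖T‖ ≤ 1 ∧ (∀ v w, ⟪Λ₁ v, T (Λ₂ w)⟫_ℂ = S v w) ∧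
      (∀ x ∈ (LinearMap.range Λ₂)ᗮ, T x = 0) ∧
      ∀ y ∈ (LinearMap.range Λ₁)ᗮ, ContinuousLinearMap.adjoint T y = 0 := by
  let K₁ := (LinearMap.range Λ₁).topologicalClosure
  let K₂ := (LinearMap.range Λ₂).topologicalClosure
  have hK₁ : CompleteSpace K₁ := (Submodule.isClosed_topologicalClosure _).completeSpace_coe
  have hK₂ : CompleteSpace K₂ := (Submodule.isClosed_topologicalClosure _).completeSpace_coe
  let e₁ : V₁ →ₗ[ℂ] K₁ := Λ₁.codRestrict K₁ fun v => Submodule.le_topologicalClosure _ ⟨v, rfl⟩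
  let e₂ : V₂ →ₗ[ℂ] K₂ := Λ₂.codRestrict K₂ fun v => Submodule.le_topologicalClosure _ ⟨v, rfl⟩
  have hd₁ : DenseRange e₁ := by
    rw [DenseRange, Subtype.dense_iff]
    intro x hx
    rw [← Set.range_comp]
    exact hx
  have hd₂ : DenseRange e₂ := by
    rw [DenseRange, Subtype.dense_iff]
    intro x hx
    rw [← Set.range_comp]
    exact hx
  have hS' : ∀ v w, ‖S v w‖ ≤ ‖Λ₁ v‖ * ‖e₂ w‖ := hS
  have hext : ∀ v w, (S v).extendOfNorm e₂ (e₂ w) = S v w := fun v w =>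
    LinearMap.extendOfNorm_eq hd₂ ⟨_, hS' v⟩ w
  let t (v : V₁) : K₂ := (InnerProductSpace.toDual ℂ K₂).symm ((S v).extendOfNorm e₂)
  have ht : ∀ v w, ⟪t v, e₂ w⟫_ℂ = S v w := fun v w =>
    InnerProductSpace.toDual_symm_apply.trans (hext v w)
  have hinj : ∀ x y : K₂, (∀ w, ⟪x, e₂ w⟫_ℂ = ⟪y, e₂ w⟫_ℂ) → x = y := fun x y h =>
    ext_inner_right ℂ fun k => congrFun (hd₂.equalizer (g := fun k => ⟪x, k⟫_ℂ)
      (h := fun k => ⟪y, k⟫_ℂ) (by fun_prop) (by fun_prop) (funext h)) k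
  -- `S` is conjugate-linear in `v` and so is the Riesz identification; the two cancel and `R` is
  -- linear.
  let R : V₁ →ₗ[ℂ] K₂ :=
    { toFun := t
      map_add' := fun v v' => hinj _ _ fun w => by simp [ht]
      map_smul' := fun c v => hinj _ _ fun w => by simp [ht, mul_comm] }
  have hR : ∀ v, ‖R v‖ ≤ 1 * ‖e₁ v‖ := fun v => by
    have h1 : ‖R v‖ = ‖(S v).extendOfNorm e₂‖ :=
      (InnerProductSpace.toDual ℂ K₂).symm.norm_map _
    rw [one_mul, h1]
    exact LinearMap.opNorm_extendOfNorm_le hd₂ (norm_nonneg _) (hS' v)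
  let U : K₁ →L[ℂ] K₂ := R.extendOfNorm e₁
  have hU : ∀ v, U (e₁ v) = t v := LinearMap.extendOfNorm_eq hd₁ ⟨1, hR⟩
  have hUn : ‖U‖ ≤ 1 := LinearMap.opNorm_extendOfNorm_le hd₁ zero_le_one hR
  -- `U` is extended by zero off `K₁` and takes values in `K₂`; this makes `T₀` vanish on `K₁ᗮ` and
  -- its adjoint, the operator sought, vanish on `K₂ᗮ`.
  let T₀ : H₁ →L[ℂ] H₂ := K₂.subtypeL.comp (U.comp K₁.orthogonalProjectionOnto)
  refine ⟨ContinuousLinearMap.adjoint T₀, ?_, fun v w => ?_, fun x hx => ?_, fun y hy => ?_⟩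
  · rw [LinearIsometryEquiv.norm_map]
    refine ContinuousLinearMap.opNorm_le_bound _ zero_le_one fun y => ?_
    calc ‖T₀ y‖ = ‖U (K₁.orthogonalProjectionOnto y)‖ := rfl
      _ ≤ 1 * ‖K₁.orthogonalProjectionOnto y‖ := U.le_of_opNorm_le hUn _
      _ ≤ 1 * ‖y‖ := by
        gcongr
        exact K₁.norm_orthogonalProjectionOnto_apply_le y
  · rw [ContinuousLinearMap.adjoint_inner_right]
    have h1 : K₁.orthogonalProjectionOnto (Λ₁ v) = e₁ v :=
      K₁.orthogonalProjectionOnto_mem_subspace_eq_self (e₁ v)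
    have h2 : T₀ (Λ₁ v) = (U (e₁ v) : H₂) := by rw [← h1]; rfl
    calc ⟪T₀ (Λ₁ v), Λ₂ w⟫_ℂ = ⟪U (e₁ v), e₂ w⟫_ℂ := by rw [h2]; rfl
      _ = S v w := by rw [hU, ht]
  · refine ext_inner_left ℂ fun y => ?_
    rw [ContinuousLinearMap.adjoint_inner_right, inner_zero_right]
    rw [← Submodule.orthogonal_closure] at hx
    exact (Submodule.mem_orthogonal _ _).1 hx _ (U (K₁.orthogonalProjectionOnto y)).2
  · rw [ContinuousLinearMap.adjoint_adjoint]
    have h1 : K₁.orthogonalProjectionOnto y = 0 := by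
      rw [Submodule.orthogonalProjectionOnto_eq_zero_iff, Submodule.orthogonal_closure]
      exact hy
    change ((U (K₁.orthogonalProjectionOnto y) : K₂) : H₂) = 0
    rw [h1, map_zero]; rfl

/-- An operator that lives on the closed spans of `s₂` and `s₁` intertwines two operators leaving
these spaces and their complements invariant as soon as it does so weakly on `s₁` and `s₂`. -/
lemma comp_eq_comp_of_inner_eq {s₁ : Set H₁} {s₂ : Set H₂} {T : H₂ →L[ℂ] H₁}
    (hT : ∀ x ∈ (Submodule.span ℂ s₂)ᗮ, T x = 0)
    (hT' : ∀ y ∈ (Submodule.span ℂ s₁)ᗮ, ContinuousLinearMap.adjoint T y = 0)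
    {c₁ d₁ : H₁ →L[ℂ] H₁} {c₂ d₂ : H₂ →L[ℂ] H₂}
    (h₁ : ∀ x y, ⟪x, c₁ y⟫_ℂ = ⟪d₁ x, y⟫_ℂ) (h₂ : ∀ x y, ⟪x, c₂ y⟫_ℂ = ⟪d₂ x, y⟫_ℂ)
    (hc₁ : ∀ x ∈ s₁, c₁ x ∈ (Submodule.span ℂ s₁).topologicalClosure)
    (hd₂ : ∀ x ∈ s₂, d₂ x ∈ (Submodule.span ℂ s₂).topologicalClosure)
    (hT'' : ∀ x ∈ s₁, ∀ y ∈ s₂, ⟪x, T (c₂ y)⟫_ℂ = ⟪d₁ x, T y⟫_ℂ) (x : H₂) :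
    T (c₂ x) = c₁ (T x) := by
  set D₁ := Submodule.span ℂ s₁
  set D₂ := Submodule.span ℂ s₂
  replace hc₁ : ∀ x ∈ D₁, c₁ x ∈ D₁.topologicalClosure := fun x hx =>
    (Submodule.span_le (p := D₁.topologicalClosure.comap (c₁ : H₁ →ₗ[ℂ] H₁))).2 hc₁ hx
  replace hd₂ : ∀ x ∈ D₂, d₂ x ∈ D₂.topologicalClosure := fun x hx =>
    (Submodule.span_le (p := D₂.topologicalClosure.comap (d₂ : H₂ →ₗ[ℂ] H₂))).2 hd₂ hx
  replace hT'' : ∀ x ∈ D₁, ∀ y ∈ D₂, ⟪x, T (c₂ y)⟫_ℂ = ⟪d₁ x, T y⟫_ℂ := fun x hx y hy => by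
    induction hx using Submodule.span_induction with
    | zero => simp
    | add _ _ _ _ h h' => simp [h, h']
    | smul _ _ _ h => simp [h]
    | mem x hx =>
      induction hy using Submodule.span_induction with
      | zero => simp
      | add _ _ _ _ h h' => simp [h, h']
      | smul _ _ _ h => simp [h]
      | mem y hy => exact hT'' x hx y hy
  -- The defect `z` is orthogonal to `D₁`, and so is `d₁ z`; the adjoint of `T` kills both, and `⟨z,
  -- z⟩ = ⟨z, T c₂ y⟩ - ⟨d₁ z, T y⟩` vanishes.
  have hD : ∀ y ∈ D₂, T (c₂ y) = c₁ (T y) := fun y hy => by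
    rw [← sub_eq_zero]
    set z := T (c₂ y) - c₁ (T y) with hz
    have hzD : z ∈ D₁ᗮ := (Submodule.mem_orthogonal _ _).2 fun u hu => by
      rw [hz, inner_sub_right, hT'' u hu y hy, h₁, sub_self]
    have hdz : d₁ z ∈ D₁ᗮ := (Submodule.mem_orthogonal' _ _).2 fun u hu => by
      rw [← h₁]
      rw [← Submodule.orthogonal_closure] at hzD
      exact (Submodule.mem_orthogonal' _ _).1 hzD _ (hc₁ u hu)
    rw [← inner_self_eq_zero (𝕜 := ℂ)]
    conv_lhs => rw [hz, inner_sub_right, ← hz, h₁]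
    rw [← ContinuousLinearMap.adjoint_inner_left T, ← ContinuousLinearMap.adjoint_inner_left T,
      hT' z hzD, hT' _ hdz]
    simp
  have hK : CompleteSpace D₂.topologicalClosure :=
    D₂.isClosed_topologicalClosure.completeSpace_coe
  -- On the closure of `D₂` the identity extends by continuity; on the complement both sides vanish,
  -- since `c₂` leaves it invariant.
  obtain ⟨k, hk, r, hr, rfl⟩ := D₂.topologicalClosure.exists_add_mem_mem_orthogonal x
  have hcr : c₂ r ∈ D₂ᗮ := (Submodule.mem_orthogonal _ _).2 fun u hu => by
    rw [h₂]
    exact (Submodule.mem_orthogonal _ _).1 hr _ (hd₂ u hu)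
  rw [Submodule.orthogonal_closure] at hr
  have hk' : T (c₂ k) = c₁ (T k) := by
    have hcl : IsClosed {k | T (c₂ k) = c₁ (T k)} := isClosed_eq (by fun_prop) (by fun_prop)
    exact closure_minimal (s := (D₂ : Set H₂)) hD hcl hk
  rw [map_add, map_add, map_add, map_add, hT _ hcr, hT _ hr, hk', map_zero]

/-- `X` maps the closure of `D₁` into that of `D₂`, and its adjoint maps `D₂` into `D₁`, so `X` also
respects the orthogonal complements. -/
lemma starProjection_topologicalClosure_comp {D₁ : Submodule ℂ H₁} {D₂ : Submodule ℂ H₂}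
    [D₁.topologicalClosure.HasOrthogonalProjection]
    [D₂.topologicalClosure.HasOrthogonalProjection] {X : H₁ →L[ℂ] H₂} (hX : ∀ u ∈ D₁, X u ∈ D₂)
    (hX' : ∀ w ∈ D₂, ContinuousLinearMap.adjoint X w ∈ D₁) (v : H₁) :
    D₂.topologicalClosure.starProjection (X v) = X (D₁.topologicalClosure.starProjection v) := by
  refine Submodule.eq_starProjection_of_mem_orthogonal
    (map_mem_closure X.continuous (Submodule.starProjection_apply_mem D₁.topologicalClosure v) hX) ?_
  rw [← map_sub, Submodule.orthogonal_closure, Submodule.mem_orthogonal]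
  intro w hw
  rw [← ContinuousLinearMap.adjoint_inner_left]
  have h := D₁.topologicalClosure.sub_starProjection_mem_orthogonal v
  rw [Submodule.orthogonal_closure] at h
  exact (Submodule.mem_orthogonal _ _).1 h _ (hX' w hw)

end HilbertSpace

/-! ### Amplification to finite Hilbert sums. -/

section Amplification

variable {H₁ H₂ H₃ : Type*} [NormedAddCommGroup H₁] [InnerProductSpace ℂ H₁]
  [NormedAddCommGroup H₂] [InnerProductSpace ℂ H₂]
  [NormedAddCommGroup H₃] [InnerProductSpace ℂ H₃]

/-- The diagonal amplification of an operator to the `ι`-fold Hilbert sums. -/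
noncomputable def amplification (ι : Type*) [Fintype ι] (X : H₁ →L[ℂ] H₂) :
    PiLp 2 (fun _ : ι => H₁) →L[ℂ] PiLp 2 (fun _ : ι => H₂) :=
  ((PiLp.continuousLinearEquiv 2 ℂ (fun _ : ι => H₂)).symm :
      (ι → H₂) →L[ℂ] PiLp 2 (fun _ : ι => H₂)).comp
    ((ContinuousLinearMap.piMap fun _ : ι => X).comp
      (PiLp.continuousLinearEquiv 2 ℂ (fun _ : ι => H₁) :
        PiLp 2 (fun _ : ι => H₁) →L[ℂ] (ι → H₁)))

variable {ι : Type*} [Fintype ι]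

@[simp]
lemma amplification_apply (X : H₁ →L[ℂ] H₂) (u : PiLp 2 (fun _ : ι => H₁)) (i : ι) :
    amplification ι X u i = X (u i) := rfl

lemma amplification_comp (X : H₂ →L[ℂ] H₃) (Y : H₁ →L[ℂ] H₂) (u : PiLp 2 (fun _ : ι => H₁)) :
    amplification ι (X.comp Y) u = amplification ι X (amplification ι Y u) := rfl

lemma inner_amplification_left [CompleteSpace H₁] [CompleteSpace H₂] (X : H₁ →L[ℂ] H₂)
    (u : PiLp 2 (fun _ : ι => H₁)) (w : PiLp 2 (fun _ : ι => H₂)) :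
    ⟪amplification ι X u, w⟫_ℂ = ⟪u, amplification ι (ContinuousLinearMap.adjoint X) w⟫_ℂ := by
  simp [PiLp.inner_apply, ContinuousLinearMap.adjoint_inner_right]

lemma adjoint_amplification [CompleteSpace H₁] [CompleteSpace H₂] (X : H₁ →L[ℂ] H₂) :
    ContinuousLinearMap.adjoint (amplification ι X) =
      amplification ι (ContinuousLinearMap.adjoint X) := by
  refine ContinuousLinearMap.ext fun w => ext_inner_left ℂ fun u => ?_
  rw [ContinuousLinearMap.adjoint_inner_right, inner_amplification_left]

end Amplification

/-! ### Hilbert modules as operators into the interior tensor product. -/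

section ModuleInner

variable {B E : Type*} [CStarAlgebra B] [PartialOrder B]
  [NormedAddCommGroup E] [NormedSpace ℂ E] [Module Bᵐᵒᵖ E] [CStarModule Bᵐᵒᵖ E]

lemma moduleInner_sub_right (x y z : E) :
    moduleInner B x (y - z) = moduleInner B x y - moduleInner B x z := by
  simp [moduleInner]

variable (B) in
lemma ext_moduleInner {x y : E} (h : ∀ z, moduleInner B z x = moduleInner B z y) : x = y := by
  rw [← sub_eq_zero, ← moduleInner_self (B := B), moduleInner_sub_right, h, sub_self]

/-- Adjointable maps are automatically `B`-linear, as one sees by pairing with an arbitrary `z`. -/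
lemma IsHilbertBimodule.smul_op_smul {A : Type*} [CStarAlgebra A] [Module A E]
    (hE : IsHilbertBimodule A B E) (a : A) (b : B) (x : E) : a • op b • x = op b • a • x := by
  have hinner : ∀ (a : A) (x y : E), moduleInner B x (a • y) = moduleInner B (star a • x) y :=
    fun a x y => by rw [hE.inner_smul, star_star]
  refine ext_moduleInner B fun z => ?_
  rw [hinner, moduleInner_op_smul_right, moduleInner_op_smul_right, hinner]

end ModuleInner

section InteriorTensor

variable {B E G : Type*} [CStarAlgebra B] [PartialOrder B] [StarOrderedRing B]
  [NormedAddCommGroup E] [NormedSpace ℂ E] [Module Bᵐᵒᵖ E] [CStarModule Bᵐᵒᵖ E]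
  [NormedAddCommGroup G] [InnerProductSpace ℂ G] [CompleteSpace G]

/-- The canonical map from the algebraic to the interior tensor product. -/
noncomputable def interiorMk (π : B →⋆ₐ[ℂ] (G →L[ℂ] G)) (E : Type*) [NormedAddCommGroup E]
    [NormedSpace ℂ E] [Module Bᵐᵒᵖ E] [CStarModule Bᵐᵒᵖ E] :
    E ⊗[ℂ] G →ₗ[ℂ] InteriorTensor π E :=
  (UniformSpace.Completion.toComplₗᵢ (𝕜 := ℂ) (E := PreInteriorTensor π E)).toLinearMap ∘ₗ
    (toPreInteriorTensor π E).toLinearMap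

lemma inner_interiorMk (π : B →⋆ₐ[ℂ] (G →L[ℂ] G)) (z w : E ⊗[ℂ] G) :
    ⟪interiorMk π E z, interiorMk π E w⟫_ℂ = preInteriorForm π E z w :=
  (UniformSpace.Completion.inner_coe _ _).trans (preInteriorTensor_inner π z w)

lemma denseRange_interiorMk (π : B →⋆ₐ[ℂ] (G →L[ℂ] G)) : DenseRange (interiorMk π E) :=
  UniformSpace.Completion.denseRange_coe.comp (toPreInteriorTensor π E).surjective.denseRange
    (UniformSpace.Completion.continuous_coe _)

lemma ext_inner_interiorTmul (π : B →⋆ₐ[ℂ] (G →L[ℂ] G)) {u v : InteriorTensor π E}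
    (h : ∀ x g, ⟪interiorTmul π x g, u⟫_ℂ = ⟪interiorTmul π x g, v⟫_ℂ) : u = v := by
  refine ext_inner_left ℂ fun w => congrFun ((denseRange_interiorMk (E := E) π).equalizer
    (g := fun w => ⟪w, u⟫_ℂ) (h := fun w => ⟪w, v⟫_ℂ) (by fun_prop) (by fun_prop)
    (funext fun z => ?_)) w
  induction z with
  | zero => simp
  | add z₁ z₂ h₁ h₂ => simpa [inner_add_left] using congrArg₂ (· + ·) h₁ h₂
  | tmul x g => exact h x g

lemma interiorTmul_op_smul (π : B →⋆ₐ[ℂ] (G →L[ℂ] G)) (x : E) (b : B) (g : G) :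
    interiorTmul π (op b • x) g = interiorTmul π x (π b g) :=
  ext_inner_interiorTmul π fun y h => by
    rw [inner_interiorTmul, inner_interiorTmul, moduleInner_op_smul_right, map_mul]; rfl

lemma adjoint_creation_apply (π : B →⋆ₐ[ℂ] (G →L[ℂ] G)) (x y : E) (g : G) :
    ContinuousLinearMap.adjoint (creation π E x) (interiorTmul π y g) =
      π (moduleInner B x y) g :=
  ext_inner_left ℂ fun h => by
    rw [ContinuousLinearMap.adjoint_inner_right, creation_apply, inner_interiorTmul]

lemma adjoint_creation_comp_creation (π : B →⋆ₐ[ℂ] (G →L[ℂ] G)) (x y : E) :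
    (ContinuousLinearMap.adjoint (creation π E x)).comp (creation π E y) =
      π (moduleInner B x y) :=
  ContinuousLinearMap.ext fun g => adjoint_creation_apply π x y g

/-- `L_x⋆ L_x = π(⟨x, x⟩)`, and an injective ⋆-homomorphism of C⋆-algebras is isometric. -/
lemma norm_creation {π : B →⋆ₐ[ℂ] (G →L[ℂ] G)} (hπ : Function.Injective π) (x : E) :
    ‖creation π E x‖ = ‖x‖ := by
  have h := ContinuousLinearMap.norm_adjoint_comp_self (creation π E x)
  rw [adjoint_creation_comp_creation, NonUnitalStarAlgHom.norm_map π hπ,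
    ← norm_sq_eq_moduleInner, ← pow_two] at h
  exact ((sq_eq_sq₀ (norm_nonneg _) (norm_nonneg _)).1 h).symm

lemma creation_injective {π : B →⋆ₐ[ℂ] (G →L[ℂ] G)} (hπ : Function.Injective π) :
    Function.Injective (creation π E) := by
  refine (injective_iff_map_eq_zero _).2 fun x hx => ?_
  rw [← norm_eq_zero, ← norm_creation hπ, hx]
  exact ContinuousLinearMap.opNorm_zero

/-- The left action of an element of `A` on `E` induces a bounded operator on `E ⊙ G`. -/
lemma IsHilbertBimodule.exists_leftAction {A : Type*} [CStarAlgebra A] [PartialOrder A]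
    [StarOrderedRing A] [Module A E] (hE : IsHilbertBimodule A B E)
    (π : B →⋆ₐ[ℂ] (G →L[ℂ] G)) (a : A) :
    ∃ α : InteriorTensor π E →L[ℂ] InteriorTensor π E,
      (∀ x g, α (interiorTmul π x g) = interiorTmul π (a • x) g) ∧
      ∀ x g, ContinuousLinearMap.adjoint α (interiorTmul π x g) =
        interiorTmul π (star a • x) g := by
  have hinner : ∀ (a : A) (x y : E), moduleInner B x (a • y) = moduleInner B (star a • x) y :=
    fun a x y => by rw [hE.inner_smul, star_star]
  let l (a : A) : E →ₗ[ℂ] E :=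
    { toFun := fun x => a • x
      map_add' := smul_add a
      map_smul' := fun c x => ext_moduleInner B fun z => by
        rw [RingHom.id_apply, hinner, moduleInner_smul_right, moduleInner_smul_right, hinner] }
  have hl : ∀ (a : A) (z w : E ⊗[ℂ] G), preInteriorForm π E z ((l a).rTensor G w) =
      preInteriorForm π E ((l (star a)).rTensor G z) w := fun a z w => by
    induction z with
    | zero => simp
    | add z₁ z₂ h₁ h₂ => simp [h₁, h₂]
    | tmul x g =>
      induction w with
      | zero => simp
      | add w₁ w₂ h₁ h₂ => simp [h₁, h₂]
      | tmul y h => simp [l, hinner]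
  have hnorm (z : E ⊗[ℂ] G) :
      ‖interiorMk π E ((l a).rTensor G z)‖ ≤ ‖a‖ * ‖interiorMk π E z‖ := by
    -- Writing `‖a‖² - a⋆a = c⋆c` gives `‖a z‖² + ‖c z‖² = ‖a‖² ‖z‖²`, hence the bound.
    obtain ⟨c, hc⟩ := CStarAlgebra.nonneg_iff_eq_star_mul_self.1
      (sub_nonneg.2 (CStarAlgebra.star_mul_le_algebraMap_norm_sq (a := a)))
    have hform : ∀ d : A, preInteriorForm π E ((l d).rTensor G z) ((l d).rTensor G z) =
        preInteriorForm π E z ((l (star d * d)).rTensor G z) := fun d => by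
      have hmul : (l (star d * d)).rTensor G z =
          (l (star d)).rTensor G ((l d).rTensor G z) := by
        rw [← LinearMap.comp_apply, ← LinearMap.rTensor_comp]
        congr 2
        exact LinearMap.ext fun x => mul_smul _ _ _
      rw [hmul, hl (star d), star_star]
    have hsum : preInteriorForm π E ((l a).rTensor G z) ((l a).rTensor G z) +
        preInteriorForm π E ((l c).rTensor G z) ((l c).rTensor G z) =
        ((‖a‖ ^ 2 : ℝ) : ℂ) * preInteriorForm π E z z := by
      have hadd : l (star a * a) + l (star c * c) = ((‖a‖ ^ 2 : ℝ) : ℂ) • LinearMap.id := by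
        refine LinearMap.ext fun x => ?_
        change (star a * a) • x + (star c * c) • x = ((‖a‖ ^ 2 : ℝ) : ℂ) • x
        rw [← add_smul, ← hc, add_sub_cancel, IsScalarTower.algebraMap_apply ℝ ℂ A,
          Algebra.algebraMap_eq_smul_one, hE.smul_complex, one_smul]
        rfl
      rw [hform, hform, ← map_add, ← LinearMap.add_apply, ← LinearMap.rTensor_add, hadd,
        LinearMap.rTensor_smul, LinearMap.rTensor_id]
      simp
    simp only [← inner_interiorMk, inner_self_eq_norm_sq_to_K] at hsum
    have hsum' : ‖interiorMk π E ((l a).rTensor G z)‖ ^ 2 +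
        ‖interiorMk π E ((l c).rTensor G z)‖ ^ 2 = ‖a‖ ^ 2 * ‖interiorMk π E z‖ ^ 2 := by
      refine Complex.ofReal_injective ?_
      push_cast at hsum ⊢
      exact hsum
    refine le_of_sq_le_sq ?_ (by positivity)
    rw [mul_pow, ← hsum']
    exact le_add_of_nonneg_right (by positivity)
  let α : InteriorTensor π E →L[ℂ] InteriorTensor π E :=
    (interiorMk π E ∘ₗ (l a).rTensor G).extendOfNorm (interiorMk π E)
  have hα (x : E) (g : G) : α (interiorTmul π x g) = interiorTmul π (a • x) g :=
    LinearMap.extendOfNorm_eq (denseRange_interiorMk π) ⟨‖a‖, hnorm⟩ (x ⊗ₜ g)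
  refine ⟨α, hα, fun x g => ext_inner_interiorTmul π fun y h => ?_⟩
  rw [ContinuousLinearMap.adjoint_inner_right, hα, inner_interiorTmul, inner_interiorTmul,
    hinner, star_star]

end InteriorTensor

/-! ### Orbit projections and strong closure. -/

section StrongClosure

variable {B E G : Type*} [CStarAlgebra B]
  [NormedAddCommGroup G] [InnerProductSpace ℂ G] [CompleteSpace G]

/-- The vectors `(π(b) uᵢ)ᵢ`, `b ∈ B`. -/
noncomputable def representationOrbit (π : B →⋆ₐ[ℂ] (G →L[ℂ] G)) {ι : Type*} [Fintype ι]
    (u : PiLp 2 (fun _ : ι => G)) : Submodule ℂ (PiLp 2 (fun _ : ι => G)) :=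
  LinearMap.range (show B →ₗ[ℂ] PiLp 2 (fun _ : ι => G) from
    { toFun := fun b => amplification ι (π b) u
      map_add' := fun x y => PiLp.ext fun i => by simp
      map_smul' := fun c x => PiLp.ext fun i => by simp })

lemma mem_representationOrbit {π : B →⋆ₐ[ℂ] (G →L[ℂ] G)} {ι : Type*} [Fintype ι]
    {u w : PiLp 2 (fun _ : ι => G)} :
    w ∈ representationOrbit π u ↔ ∃ b, amplification ι (π b) u = w :=
  LinearMap.mem_range

/-- The orbit is invariant under the amplified `π(b)` and their adjoints, so its projection lies in
the commutant. -/
lemma starProjection_amplification_representation {ι : Type*} [Fintype ι]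
    (π : B →⋆ₐ[ℂ] (G →L[ℂ] G)) (u v : PiLp 2 (fun _ : ι => G)) (b : B) :
    (representationOrbit π u).topologicalClosure.starProjection (amplification ι (π b) v) =
      amplification ι (π b)
        ((representationOrbit π u).topologicalClosure.starProjection v) := by
  refine starProjection_topologicalClosure_comp ?_ ?_ v <;>
    simp only [mem_representationOrbit]
  · rintro _ ⟨c, rfl⟩
    exact ⟨b * c, PiLp.ext fun i => by simp⟩
  · rintro _ ⟨c, rfl⟩
    rw [adjoint_amplification, ← ContinuousLinearMap.star_eq_adjoint, ← map_star]
    exact ⟨star b * c, PiLp.ext fun i => by simp⟩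

variable [PartialOrder B] [StarOrderedRing B]
  [NormedAddCommGroup E] [NormedSpace ℂ E] [Module Bᵐᵒᵖ E] [CStarModule Bᵐᵒᵖ E]

/-- The vectors `(x ⊙ uᵢ)ᵢ`, `x ∈ E`. -/
noncomputable def creationOrbit (π : B →⋆ₐ[ℂ] (G →L[ℂ] G)) (E : Type*) [NormedAddCommGroup E]
    [NormedSpace ℂ E] [Module Bᵐᵒᵖ E] [CStarModule Bᵐᵒᵖ E] {ι : Type*} [Fintype ι]
    (u : PiLp 2 (fun _ : ι => G)) : Submodule ℂ (PiLp 2 (fun _ : ι => InteriorTensor π E)) :=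
  LinearMap.range (show E →ₗ[ℂ] PiLp 2 (fun _ : ι => InteriorTensor π E) from
    { toFun := fun x => amplification ι (creation π E x) u
      map_add' := fun x y => PiLp.ext fun i =>
        congrArg (fun X : G →L[ℂ] InteriorTensor π E => X (u i)) (map_add (creation π E) x y)
      map_smul' := fun c x => PiLp.ext fun i =>
        congrArg (fun X : G →L[ℂ] InteriorTensor π E => X (u i)) (map_smul (creation π E) c x) })

lemma mem_creationOrbit {π : B →⋆ₐ[ℂ] (G →L[ℂ] G)} {ι : Type*} [Fintype ι]
    {u : PiLp 2 (fun _ : ι => G)} {w : PiLp 2 (fun _ : ι => InteriorTensor π E)} :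
    w ∈ creationOrbit π E u ↔ ∃ x, amplification ι (creation π E x) u = w :=
  LinearMap.mem_range

/-- An operator from `G` to `E ⊙ G` is in the strong closure of `E` if on every finite family of
vectors it can be approximated by elements of `E`. -/
lemma mem_closure_creationImage_univ {π : B →⋆ₐ[ℂ] (G →L[ℂ] G)} {X : G →L[ℂ] InteriorTensor π E}
    (hX : ∀ (s : Finset G) (u : PiLp 2 (fun _ : s => G)),
      amplification s X u ∈ (creationOrbit π E u).topologicalClosure) :
    X.toPointwiseConvergenceCLM ℂ (RingHom.id ℂ) G (InteriorTensor π E) ∈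
      closure (creationImage π (Set.univ : Set E)) := by
  rw [(PointwiseConvergenceCLM.isEmbedding_coeFn (σ := RingHom.id ℂ) (E := G)
    (F := InteriorTensor π E)).isInducing.closure_eq_preimage_closure_image, Set.mem_preimage,
    mem_closure_iff]
  intro o ho hXo
  obtain ⟨s, U, hU, hUo⟩ := isOpen_pi_iff.1 ho _ hXo
  -- A basic neighbourhood constrains only the values on the finite set `s`; listing `s` itself as a
  -- family turns these into one condition in the Hilbert sum.
  let u : PiLp 2 (fun _ : s => G) := WithLp.toLp 2 Subtype.val
  have hopen : IsOpen {w : PiLp 2 (fun _ : s => InteriorTensor π E) | ∀ i : s, w i ∈ U i} := by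
    simp only [Set.ofPred_forall]
    exact isOpen_iInter_of_finite fun i => (hU i i.2).1.preimage (by fun_prop)
  obtain ⟨w, hw, hw'⟩ := mem_closure_iff.1 (hX s u) _ hopen fun i => (hU i i.2).2
  obtain ⟨x, rfl⟩ := mem_creationOrbit.1 hw'
  exact ⟨_, hUo fun g hg => hw ⟨g, hg⟩, _, ⟨x, trivial, rfl⟩, rfl⟩

variable {ι : Type*} [Fintype ι]

/-- `L_x` carries the orbit `B u` into `E u` because `x ⊙ b uᵢ = x b ⊙ uᵢ`, and its adjoint carries
`y ⊙ uᵢ` back to `⟨x, y⟩ uᵢ`. -/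
lemma starProjection_amplification_creation (π : B →⋆ₐ[ℂ] (G →L[ℂ] G))
    (u v : PiLp 2 (fun _ : ι => G)) (x : E) :
    (creationOrbit π E u).topologicalClosure.starProjection
        (amplification ι (creation π E x) v) =
      amplification ι (creation π E x)
        ((representationOrbit π u).topologicalClosure.starProjection v) := by
  refine starProjection_topologicalClosure_comp ?_ ?_ v <;>
    simp only [mem_creationOrbit, mem_representationOrbit]
  · rintro _ ⟨b, rfl⟩
    exact ⟨op b • x, PiLp.ext fun i => interiorTmul_op_smul π x b (u i)⟩
  · rintro _ ⟨y, rfl⟩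
    rw [adjoint_amplification]
    exact ⟨moduleInner B x y, PiLp.ext fun i => (adjoint_creation_apply π x y (u i)).symm⟩

end StrongClosure

/-! ### Operators with coefficients in `B` preserve strong closures. -/

section Intertwiner

variable {B G F₁ F₂ I₁ I₂ : Type*} [CStarAlgebra B] [PartialOrder B] [StarOrderedRing B]
  [NormedAddCommGroup F₁] [NormedSpace ℂ F₁] [Module Bᵐᵒᵖ F₁] [CStarModule Bᵐᵒᵖ F₁]
  [NormedAddCommGroup F₂] [NormedSpace ℂ F₂] [Module Bᵐᵒᵖ F₂] [CStarModule Bᵐᵒᵖ F₂]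
  [NormedAddCommGroup G] [InnerProductSpace ℂ G] [CompleteSpace G]

lemma mem_orthogonal_span_of_forall {H : Type*} [NormedAddCommGroup H] [InnerProductSpace ℂ H]
    {s : Set H} {x : H} (h : ∀ u ∈ s, ⟪u, x⟫_ℂ = 0) : x ∈ (Submodule.span ℂ s)ᗮ := by
  refine (Submodule.mem_orthogonal _ _).2 fun u hu => ?_
  induction hu using Submodule.span_induction with
  | zero => simp
  | add _ _ _ _ h h' => simp [inner_add_left, h, h']
  | smul _ _ _ h => simp [inner_smul_left, h]
  | mem u hu => exact h u hu

/-- The elementary tensors `xⱼ ⊙ g` with `g ∈ G`. -/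
def interiorTmulSet {E I : Type*} [NormedAddCommGroup E] [NormedSpace ℂ E] [Module Bᵐᵒᵖ E]
    [CStarModule Bᵐᵒᵖ E] (π : B →⋆ₐ[ℂ] (G →L[ℂ] G)) (x : I → E) : Set (InteriorTensor π E) :=
  {w | ∃ j g, w = interiorTmul π (x j) g}

variable {π : B →⋆ₐ[ℂ] (G →L[ℂ] G)}

lemma interiorTmul_zero {E : Type*} [NormedAddCommGroup E] [NormedSpace ℂ E] [Module Bᵐᵒᵖ E]
    [CStarModule Bᵐᵒᵖ E] (π : B →⋆ₐ[ℂ] (G →L[ℂ] G)) (x : E) : interiorTmul π x 0 = 0 :=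
  map_zero (creation π E x)

/-- Testing `w` against vectors supported in a single coordinate shows that each coordinate of `w`
is orthogonal to the tensors `xⱼ ⊙ g`. -/
lemma amplification_eq_zero {E F I ι : Type*} [Fintype ι] [NormedAddCommGroup E]
    [NormedSpace ℂ E] [Module Bᵐᵒᵖ E] [CStarModule Bᵐᵒᵖ E] [NormedAddCommGroup F]
    [InnerProductSpace ℂ F] {x : I → E} {T : InteriorTensor π E →L[ℂ] F}
    (hT : ∀ z ∈ (Submodule.span ℂ (interiorTmulSet π x))ᗮ, T z = 0)
    (w : PiLp 2 (fun _ : ι => InteriorTensor π E))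
    (hw : w ∈ (Submodule.span ℂ {w | ∃ j v, w = amplification ι (creation π E (x j)) v})ᗮ) :
    amplification ι T w = 0 := by
  classical
  refine PiLp.ext fun i => hT _ (mem_orthogonal_span_of_forall ?_)
  rintro _ ⟨j, g, rfl⟩
  have h := (Submodule.mem_orthogonal _ _).1 hw _
    (Submodule.subset_span ⟨j, WithLp.toLp 2 (Pi.single i g), rfl⟩)
  rw [PiLp.inner_apply, Finset.sum_eq_single i] at h
  · simpa using h
  · intro k _ hk
    simp [hk, interiorTmul_zero]
  · simp

/-- An operator `F₂ ⊙ G → F₁ ⊙ G` with matrix entries in `B` maps `F₂` into the strong closure of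
`F₁`. -/
lemma comp_creation_mem_closure {x₁ : I₁ → F₁} {x₂ : I₂ → F₂}
    {T : InteriorTensor π F₂ →L[ℂ] InteriorTensor π F₁}
    (hT : ∀ z ∈ (Submodule.span ℂ (interiorTmulSet π x₂))ᗮ, T z = 0)
    (hT' : ∀ z ∈ (Submodule.span ℂ (interiorTmulSet π x₁))ᗮ, ContinuousLinearMap.adjoint T z = 0)
    {θ : I₁ → I₂ → B}
    (hθ : ∀ j k g h, ⟪interiorTmul π (x₁ j) g, T (interiorTmul π (x₂ k) h)⟫_ℂ = ⟪g, π (θ j k) h⟫_ℂ)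
    (x : F₂) :
    (T.comp (creation π F₂ x)).toPointwiseConvergenceCLM ℂ (RingHom.id ℂ) G (InteriorTensor π F₁) ∈
      closure (creationImage π (Set.univ : Set F₁)) := by
  refine mem_closure_creationImage_univ fun s u => ?_
  rw [amplification_comp]
  have hθ' : ∀ j k (v w : PiLp 2 (fun _ : s => G)),
      ⟪amplification s (creation π F₁ (x₁ j)) v,
        amplification s T (amplification s (creation π F₂ (x₂ k)) w)⟫_ℂ =
      ⟪v, amplification s (π (θ j k)) w⟫_ℂ := fun j k v w => by
    simp only [PiLp.inner_apply, amplification_apply, creation_apply, hθ]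
  -- The orbit projections slide through creation operators to the projection onto `B u`, which
  -- commutes with the amplified coefficients `π (θ j k)`.
  have key := comp_eq_comp_of_inner_eq (T := amplification s T)
    (c₁ := (creationOrbit π F₁ u).topologicalClosure.starProjection)
    (d₁ := (creationOrbit π F₁ u).topologicalClosure.starProjection)
    (c₂ := (creationOrbit π F₂ u).topologicalClosure.starProjection)
    (d₂ := (creationOrbit π F₂ u).topologicalClosure.starProjection)
    (amplification_eq_zero hT)
    (by rw [adjoint_amplification]; exact amplification_eq_zero hT')
    (fun x y => (Submodule.inner_starProjection_left_eq_right _ x y).symm)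
    (fun x y => (Submodule.inner_starProjection_left_eq_right _ x y).symm)
    (by
      rintro _ ⟨j, v, rfl⟩
      rw [starProjection_amplification_creation]
      exact Submodule.le_topologicalClosure _ (Submodule.subset_span ⟨j, _, rfl⟩))
    (by
      rintro _ ⟨j, v, rfl⟩
      rw [starProjection_amplification_creation]
      exact Submodule.le_topologicalClosure _ (Submodule.subset_span ⟨j, _, rfl⟩))
    (by
      rintro _ ⟨j, v, rfl⟩ _ ⟨k, w, rfl⟩
      rw [starProjection_amplification_creation, starProjection_amplification_creation, hθ', hθ',
        ← starProjection_amplification_representation,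
        Submodule.inner_starProjection_left_eq_right])
    (amplification s (creation π F₂ x) u)
  have hmem : amplification s (creation π F₂ x) u ∈ (creationOrbit π F₂ u).topologicalClosure :=
    
    Submodule.le_topologicalClosure _ (mem_creationOrbit.2 ⟨x, rfl⟩)
  -- The vector already lies in the orbit of `F₂`, so its image under `T` is fixed by the projection
  -- for `F₁`.
  rw [Submodule.starProjection_eq_self_iff.2 hmem] at key
  rw [key]
  exact Submodule.starProjection_apply_mem _ _

end Intertwiner

/-! ### Descent to adjointable maps of von Neumann modules. -/

section VonNeumannModule

variable {G F₁ F₂ I₁ I₂ : Type*} [NormedAddCommGroup G] [InnerProductSpace ℂ G] [CompleteSpace G]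
  {B : VonNeumannAlgebra G}
  [NormedAddCommGroup F₁] [NormedSpace ℂ F₁] [Module Bᵐᵒᵖ F₁] [CStarModule Bᵐᵒᵖ F₁]
  [NormedAddCommGroup F₂] [NormedSpace ℂ F₂] [Module Bᵐᵒᵖ F₂] [CStarModule Bᵐᵒᵖ F₂]

lemma VonNeumannAlgebra.inclusion_injective (B : VonNeumannAlgebra G) :
    Function.Injective B.inclusion := Subtype.val_injective

/-- This is where strong closedness of the module enters: the limit of creation operators is again
one. -/
lemma IsVonNeumannModule.exists_eq_comp_creation (h₁ : IsVonNeumannModule B F₁)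
    {x₁ : I₁ → F₁} {x₂ : I₂ → F₂}
    {T : InteriorTensor B.inclusion F₂ →L[ℂ] InteriorTensor B.inclusion F₁}
    (hT : ∀ z ∈ (Submodule.span ℂ (interiorTmulSet B.inclusion x₂))ᗮ, T z = 0)
    (hT' : ∀ z ∈ (Submodule.span ℂ (interiorTmulSet B.inclusion x₁))ᗮ,
      ContinuousLinearMap.adjoint T z = 0)
    {θ : I₁ → I₂ → B}
    (hθ : ∀ j k g h, ⟪interiorTmul B.inclusion (x₁ j) g,
      T (interiorTmul B.inclusion (x₂ k) h)⟫_ℂ = ⟪g, B.inclusion (θ j k) h⟫_ℂ) (x : F₂) :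
    ∃ z : F₁, creation B.inclusion F₁ z = T.comp (creation B.inclusion F₂ x) := by
  have h := comp_creation_mem_closure hT hT' hθ x
  rw [IsClosed.closure_eq h₁] at h
  obtain ⟨z, -, hz⟩ := h
  exact ⟨z, ContinuousLinearMap.ext fun g => congrArg (fun X => X g) hz⟩

/-- An operator `F₂ ⊙ G → F₁ ⊙ G` with matrix entries in `B` is induced by an adjointable map of
von Neumann modules. -/
lemma IsVonNeumannModule.exists_adjointable (h₁ : IsVonNeumannModule B F₁)
    (h₂ : IsVonNeumannModule B F₂) {x₁ : I₁ → F₁} {x₂ : I₂ → F₂}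
    {T : InteriorTensor B.inclusion F₂ →L[ℂ] InteriorTensor B.inclusion F₁} (hTn : ‖T‖ ≤ 1)
    (hT : ∀ z ∈ (Submodule.span ℂ (interiorTmulSet B.inclusion x₂))ᗮ, T z = 0)
    (hT' : ∀ z ∈ (Submodule.span ℂ (interiorTmulSet B.inclusion x₁))ᗮ,
      ContinuousLinearMap.adjoint T z = 0)
    {θ : I₁ → I₂ → B}
    (hθ : ∀ j k g h, ⟪interiorTmul B.inclusion (x₁ j) g,
      T (interiorTmul B.inclusion (x₂ k) h)⟫_ℂ = ⟪g, B.inclusion (θ j k) h⟫_ℂ) :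
    ∃ (t : F₂ →L[ℂ] F₁) (t' : F₁ → F₂), ‖t‖ ≤ 1 ∧
      (∀ x g, interiorTmul B.inclusion (t x) g = T (interiorTmul B.inclusion x g)) ∧
      ∀ x y, moduleInner B (t x) y = moduleInner B x (t' y) := by
  choose t ht using h₁.exists_eq_comp_creation hT hT' hθ
  -- The adjoint of `T` has coefficients `θ⋆`, again in `B`, so the same descent applies with `F₁`
  -- and `F₂` exchanged.
  have hθ' : ∀ k j g h, ⟪interiorTmul B.inclusion (x₂ k) g,
      ContinuousLinearMap.adjoint T (interiorTmul B.inclusion (x₁ j) h)⟫_ℂ =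
      ⟪g, B.inclusion (star (θ j k)) h⟫_ℂ := fun k j g h => by
    rw [ContinuousLinearMap.adjoint_inner_right, ← inner_conj_symm, hθ, inner_conj_symm,
      map_star, ContinuousLinearMap.star_eq_adjoint, ContinuousLinearMap.adjoint_inner_right]
  choose t' ht' using h₂.exists_eq_comp_creation hT'
    (by rw [ContinuousLinearMap.adjoint_adjoint]; exact hT) hθ'
  have hinj := creation_injective (E := F₁) B.inclusion_injective
  have hadj (x : F₂) (y : F₁) : moduleInner B (t x) y = moduleInner B x (t' y) := by
    refine B.inclusion_injective ?_
    rw [← adjoint_creation_comp_creation B.inclusion (t x) y,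
      ← adjoint_creation_comp_creation B.inclusion x (t' y), ht, ht',
      ContinuousLinearMap.adjoint_comp, ContinuousLinearMap.comp_assoc]
  have hta (x : F₂) (g : G) :
      interiorTmul B.inclusion (t x) g = T (interiorTmul B.inclusion x g) :=
    congrArg (fun X : G →L[ℂ] InteriorTensor B.inclusion F₁ => X g) (ht x)
  let t₀ : F₂ →ₗ[ℂ] F₁ :=
    { toFun := t
      map_add' := fun x y => hinj <| by
        rw [map_add, ht, ht, ht, map_add, ContinuousLinearMap.comp_add]
      map_smul' := fun c x => hinj <| ContinuousLinearMap.ext fun g => by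
        have h₃ := congrArg (fun X : G →L[ℂ] InteriorTensor B.inclusion F₂ => X g)
          (map_smul (creation B.inclusion F₂) c x)
        have h₄ := congrArg (fun X : G →L[ℂ] InteriorTensor B.inclusion F₁ => X g)
          (map_smul (creation B.inclusion F₁) c (t x))
        exact ((hta _ g).trans (congrArg T h₃)).trans
          ((T.map_smul c _).trans ((congrArg (c • ·) (hta x g).symm).trans h₄.symm)) }
  have hbound (x : F₂) : ‖t₀ x‖ ≤ 1 * ‖x‖ := by
    have h : ‖creation B.inclusion F₁ (t x)‖ ≤ ‖T‖ * ‖creation B.inclusion F₂ x‖ :=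
      (congrArg norm (ht x)).trans_le (ContinuousLinearMap.opNorm_comp_le T _)
    have e₁ : ‖creation B.inclusion F₁ (t x)‖ = ‖t x‖ := norm_creation B.inclusion_injective _
    have e₂ : ‖creation B.inclusion F₂ x‖ = ‖x‖ := norm_creation B.inclusion_injective _
    rw [e₁, e₂] at h
    exact h.trans (mul_le_mul_of_nonneg_right hTn (norm_nonneg x))
  exact ⟨t₀.mkContinuous 1 hbound, t', t₀.mkContinuous_norm_le zero_le_one _,
    hta, hadj⟩

end VonNeumannModule

/-! ### Complete positivity and the Cauchy–Schwarz bound. -/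

section CompletelyPositive

open scoped ComplexOrder in
/-- A positive matrix over a C⋆-algebra of operator matrices has positive quadratic form. -/
lemma CStarMatrix.sum_inner_nonneg {B G κ : Type*} [CStarAlgebra B] [PartialOrder B]
    [StarOrderedRing B] [NormedAddCommGroup G] [InnerProductSpace ℂ G] [CompleteSpace G]
    [Fintype κ] (π : B →⋆ₐ[ℂ] (G →L[ℂ] G))
    {X : CStarMatrix κ κ (CStarMatrix (Fin 2) (Fin 2) B)} (hX : 0 ≤ X) (g : κ → Fin 2 → G) :
    0 ≤ ∑ p, ∑ q, ∑ i, ∑ j, ⟪g p i, π (X p q i j) (g q j)⟫_ℂ := by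
  classical
  obtain ⟨D, hD⟩ := CStarAlgebra.exists_star_mul_self_of_nonneg hX
  have hXe (p q : κ) (i j : Fin 2) : X p q i j = ∑ r, ∑ l, star (D r p l i) * D r q l j := by
    rw [hD, CStarMatrix.mul_apply]
    have : (∑ r, (star D) p r * D r q) i j = ∑ r, ((star D) p r * D r q) i j := by
      exact map_sum (AddMonoidHom.mk' (fun M : CStarMatrix (Fin 2) (Fin 2) B => M i j)
        fun _ _ => rfl) _ _
    rw [this]
    refine Finset.sum_congr rfl fun r _ => ?_
    rw [CStarMatrix.mul_apply]
    rfl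
  have key : ∑ p, ∑ q, ∑ i, ∑ j, ⟪g p i, π (X p q i j) (g q j)⟫_ℂ =
      ∑ r, ∑ l, ⟪∑ p, ∑ i, π (D r p l i) (g p i), ∑ p, ∑ i, π (D r p l i) (g p i)⟫_ℂ := by
    have hrw (p q : κ) (i j : Fin 2) : ⟪g p i, π (X p q i j) (g q j)⟫_ℂ =
        ∑ r, ∑ l, ⟪π (D r p l i) (g p i), π (D r q l j) (g q j)⟫_ℂ := by
      simp only [hXe, map_sum, map_mul, map_star, sum_apply, mul_apply_eq_comp, inner_sum,
        ContinuousLinearMap.star_eq_adjoint, ContinuousLinearMap.adjoint_inner_right]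
    simp only [hrw, sum_inner, inner_sum, ← Fintype.sum_prod_type']
    exact Fintype.sum_equiv
      ⟨fun ⟨p, q, i, j, r, l⟩ => ⟨r, l, ⟨q, j⟩, p, i⟩,
        fun ⟨r, l, ⟨q, j⟩, p, i⟩ => ⟨p, q, i, j, r, l⟩,
        fun _ => rfl, fun _ => rfl⟩ _ _ fun _ => rfl
  rw [key]
  exact Finset.sum_nonneg fun r _ => Finset.sum_nonneg fun l _ => RCLike.nonneg_iff.2
    ⟨inner_self_nonneg, inner_self_im _⟩

/-- The off-diagonal entry of a positive semidefinite hermitian form on `ℂ²` is dominated by the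
diagonal entries. -/
lemma norm_le_mul_of_forall_nonneg {z : ℂ} {a b : ℝ} (ha : 0 ≤ a) (hb : 0 ≤ b)
    (h : ∀ c d : ℂ, 0 ≤ ‖c‖ ^ 2 * a ^ 2 + ‖d‖ ^ 2 * b ^ 2 + 2 * (starRingEnd ℂ c * d * z).re) :
    ‖z‖ ≤ a * b := by
  have key : ∀ r s : ℝ, 2 * (r * s * ‖z‖) ≤ r ^ 2 * a ^ 2 + s ^ 2 * b ^ 2 := fun r s => by
    rcases eq_or_ne z 0 with rfl | hz
    · simp; positivity
    have hz' : (‖z‖ : ℂ) ≠ 0 := by simpa using hz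
    -- The phase is chosen so that the cross term becomes `-2 r s ‖z‖`.
    have h1 := h (-(r * (z / ‖z‖))) s
    have h2 : starRingEnd ℂ (-(r * (z / ‖z‖))) * s * z = ((-(r * s * ‖z‖) : ℝ) : ℂ) := by
      have : starRingEnd ℂ z * z = (‖z‖ : ℂ) ^ 2 := by
        rw [mul_comm, Complex.mul_conj, Complex.normSq_eq_norm_sq]; push_cast; rfl
      simp only [map_neg, map_mul, map_div₀, Complex.conj_ofReal]
      push_cast
      field_simp
      linear_combination (-(r * s) : ℂ) * this
    rw [h2, Complex.ofReal_re] at h1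
    have h3 : ‖-(r * (z / ‖z‖))‖ ^ 2 = r ^ 2 := by
      simp [hz]
    have h4 : ‖(s : ℂ)‖ ^ 2 = s ^ 2 := by simp
    rw [h3, h4] at h1
    linarith
  by_contra! hlt
  rcases ha.eq_or_lt with rfl | ha'
  · have hz : 0 < ‖z‖ := by simpa using hlt
    -- With `a = 0` this choice gives `2 (b² + 1) ≤ b²`, which is absurd.
    have := key ((b ^ 2 + 1) / ‖z‖) 1
    have h5 : (b ^ 2 + 1) / ‖z‖ * 1 * ‖z‖ = b ^ 2 + 1 := by field_simp
    rw [h5] at this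
    nlinarith [sq_nonneg b]
  rcases hb.eq_or_lt with rfl | hb'
  · have hz : 0 < ‖z‖ := by simpa using hlt
    have := key 1 ((a ^ 2 + 1) / ‖z‖)
    have h5 : 1 * ((a ^ 2 + 1) / ‖z‖) * ‖z‖ = a ^ 2 + 1 := by field_simp
    rw [h5] at this
    nlinarith [sq_nonneg a]
  -- Here `2 a b ‖z‖ ≤ 2 a² b²`, and `a b > 0` can be cancelled.
  have := key b a
  nlinarith [mul_pos ha' hb']

/-- The form `⟨a ⊗ g, a' ⊗ h⟩ = ⟨g, π(θ(a⋆a')) h⟩` on the finitely supported functions `A → G`. -/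
noncomputable def stinespringForm {A B G : Type*} [CStarAlgebra A] [CStarAlgebra B]
    [NormedAddCommGroup G] [InnerProductSpace ℂ G] [CompleteSpace G]
    (π : B →⋆ₐ[ℂ] (G →L[ℂ] G)) (θ : A → B) : (A →₀ G) →ₗ⋆[ℂ] (A →₀ G) →ₗ[ℂ] ℂ :=
  LinearMap.mk₂'ₛₗ (starRingEnd ℂ) (RingHom.id ℂ)
    (fun v w => v.sum fun a g => w.sum fun a' h => ⟪g, π (θ (star a * a')) h⟫_ℂ)
    (fun v v' w => by
      classical
      exact Finsupp.sum_add_index' (by simp) (by simp [Finsupp.sum_add]))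
    (fun c v w => by
      rw [Finsupp.sum_smul_index' (by simp), Finsupp.smul_sum]
      refine Finsupp.sum_congr fun a _ => ?_
      rw [Finsupp.smul_sum]
      simp only [inner_smul_left, smul_eq_mul])
    (fun v w w' => by
      classical
      rw [← Finsupp.sum_add]
      exact Finsupp.sum_congr fun a _ => Finsupp.sum_add_index' (by simp) (by simp))
    (fun c v w => by
      rw [RingHom.id_apply, Finsupp.smul_sum]
      refine Finsupp.sum_congr fun a _ => ?_
      rw [Finsupp.sum_smul_index' (by simp), Finsupp.smul_sum]
      simp only [map_smul, inner_smul_right, smul_eq_mul])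

section StinespringForm

variable {A B G : Type*} [CStarAlgebra A] [CStarAlgebra B]
  [NormedAddCommGroup G] [InnerProductSpace ℂ G] [CompleteSpace G]

lemma stinespringForm_single (π : B →⋆ₐ[ℂ] (G →L[ℂ] G)) (θ : A → B) (a a' : A) (g h : G) :
    stinespringForm π θ (Finsupp.single a g) (Finsupp.single a' h) =
      ⟪g, π (θ (star a * a')) h⟫_ℂ := by
  simp [stinespringForm]

lemma stinespringForm_eq_sum (π : B →⋆ₐ[ℂ] (G →L[ℂ] G)) (θ : A → B) {s : Finset A}
    {v w : A →₀ G} (hv : v.support ⊆ s) (hw : w.support ⊆ s) :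
    stinespringForm π θ v w = ∑ p : s, ∑ q : s, ⟪v p, π (θ (star (p : A) * q)) (w q)⟫_ℂ := by
  change (v.sum fun a g => w.sum fun a' h => ⟪g, π (θ (star a * a')) h⟫_ℂ) = _
  rw [Finsupp.sum_of_support_subset v hv _ (by simp), ← Finset.sum_coe_sort]
  refine Finset.sum_congr rfl fun p _ => ?_
  rw [Finsupp.sum_of_support_subset w hw _ (by simp), ← Finset.sum_coe_sort]

open scoped ComplexOrder in
/-- Complete positivity of a block map bounds its off-diagonal corner by the diagonal. -/
lemma norm_stinespringForm_le [PartialOrder A] [StarOrderedRing A] [PartialOrder B]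
    [StarOrderedRing B] (π : B →⋆ₐ[ℂ] (G →L[ℂ] G))
    {φ₁ φ₂ ψ : A → B}
    (Φ : CStarMatrix (Fin 2) (Fin 2) A →CP CStarMatrix (Fin 2) (Fin 2) B)
    (hΦ : ∀ M : CStarMatrix (Fin 2) (Fin 2) A,
      Φ M = CStarMatrix.ofMatrix
        !![φ₁ (M 0 0), ψ (M 0 1); star (ψ (star (M 1 0))), φ₂ (M 1 1)])
    (v w : A →₀ G) {a b : ℝ} (ha : 0 ≤ a) (hb : 0 ≤ b)
    (hv : stinespringForm π φ₁ v v = (a ^ 2 : ℝ)) (hw : stinespringForm π φ₂ w w = (b ^ 2 : ℝ)) :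
    ‖stinespringForm π ψ v w‖ ≤ a * b := by
  classical
  have hpos (v w : A →₀ G) : 0 ≤ stinespringForm π φ₁ v v + stinespringForm π ψ v w +
      (starRingEnd ℂ (stinespringForm π ψ v w) + stinespringForm π φ₂ w w) := by
    -- Inserting `0` keeps the index set nonempty, so that `D` has a row `o` to carry its entries.
    let s := insert 0 (v.support ∪ w.support)
    have hs₁ : v.support ⊆ s := Finset.subset_union_left.trans (Finset.subset_insert _ _)
    have hs₂ : w.support ⊆ s := Finset.subset_union_right.trans (Finset.subset_insert _ _)
    let o : s := ⟨0, Finset.mem_insert_self _ _⟩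
    -- All four entries of `C(p)⋆ C(q)` equal `p⋆q`, so applying `Φ` to the blocks of `D⋆D`
    -- evaluates `φ₁`, `ψ` and `φ₂` at `p⋆q`, and `ψ⋆` gives `ψ(q⋆p)⋆`.
    let C (p : s) : CStarMatrix (Fin 2) (Fin 2) A := CStarMatrix.ofMatrix !![(p : A), p; 0, 0]
    let D : CStarMatrix s s (CStarMatrix (Fin 2) (Fin 2) A) :=
      CStarMatrix.ofMatrix fun r q => if r = o then C q else 0
    have hDe (r q : s) : D r q = if r = o then C q else 0 := rfl
    have hD (p q : s) : (star D * D) p q = star (C p) * C q := by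
      rw [CStarMatrix.mul_apply, Finset.sum_eq_single o]
      · rw [CStarMatrix.star_apply, hDe, hDe, if_pos rfl, if_pos rfl]
      · intro r _ hr
        rw [hDe r q, if_neg hr, mul_zero]
      · simp
    have hC (p q : s) (i j : Fin 2) : (star (C p) * C q) i j = star (p : A) * q := by
      rw [CStarMatrix.mul_apply, Fin.sum_univ_two]
      fin_cases i <;> fin_cases j <;>
        simp [CStarMatrix.star_apply, C, CStarMatrix.ofMatrix_apply]
    have h := CStarMatrix.sum_inner_nonneg π
      (Φ.map_cstarMatrix_nonneg _ (star_mul_self_nonneg D)) fun p : s => ![v p, w p]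
    have hsum (p q : s) : ∑ i, ∑ j, ⟪![v p, w p] i,
        π ((star D * D).map Φ p q i j) (![v q, w q] j)⟫_ℂ =
        ⟪v p, π (φ₁ (star (p : A) * q)) (v q)⟫_ℂ + ⟪v p, π (ψ (star (p : A) * q)) (w q)⟫_ℂ +
        (starRingEnd ℂ ⟪v q, π (ψ (star (q : A) * p)) (w p)⟫_ℂ +
          ⟪w p, π (φ₂ (star (p : A) * q)) (w q)⟫_ℂ) := by
      have hadj : ⟪w p, π (star (ψ (star (star (p : A) * q)))) (v q)⟫_ℂ =
          starRingEnd ℂ ⟪v q, π (ψ (star (q : A) * p)) (w p)⟫_ℂ := by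
        rw [map_star, ContinuousLinearMap.star_eq_adjoint,
          ContinuousLinearMap.adjoint_inner_right, inner_conj_symm, star_mul, star_star]
      rw [CStarMatrix.map_apply, hD, hΦ]
      simp only [hC, Fin.sum_univ_two, CStarMatrix.ofMatrix_apply, Matrix.of_apply,
        Matrix.cons_val_zero, Matrix.cons_val_one, hadj]
    simp only [hsum, Finset.sum_add_distrib] at h
    rw [stinespringForm_eq_sum π φ₁ hs₁ hs₁, stinespringForm_eq_sum π φ₂ hs₂ hs₂,
      stinespringForm_eq_sum π ψ hs₁ hs₂, map_sum]
    simp only [map_sum]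
    -- The lower left corner produces the conjugate terms with `p` and `q` interchanged.
    rw [Finset.sum_comm (f := fun p q : s =>
      starRingEnd ℂ ⟪v p, π (ψ (star (p : A) * q)) (w q)⟫_ℂ)]
    exact h
  refine norm_le_mul_of_forall_nonneg ha hb fun c d => ?_
  have h := (Complex.nonneg_iff.1 (hpos (c • v) (d • w))).1
  simp only [map_smulₛₗ, LinearMap.smul_apply, RingHom.id_apply, smul_eq_mul, hv, hw] at h
  convert! h using 1
  rw [Complex.sq_norm, Complex.sq_norm, Complex.normSq_apply, Complex.normSq_apply]
  simp [pow_two]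
  ring

end StinespringForm

end CompletelyPositive

/-! ### Stinespring vectors of a GNS-representation. -/

section StinespringMap

variable {A B E G : Type*} [CStarAlgebra A] [CStarAlgebra B] [PartialOrder B] [StarOrderedRing B]
  [NormedAddCommGroup E] [NormedSpace ℂ E] [Module Bᵐᵒᵖ E] [CStarModule Bᵐᵒᵖ E] [Module A E]
  [NormedAddCommGroup G] [InnerProductSpace ℂ G] [CompleteSpace G]

/-- The map `a ⊗ g ↦ a ξ ⊙ g`. -/
noncomputable def stinespringMap (A : Type*) [CStarAlgebra A] [Module A E]
    (π : B →⋆ₐ[ℂ] (G →L[ℂ] G)) (ξ : E) : (A →₀ G) →ₗ[ℂ] InteriorTensor π E :=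
  Finsupp.lsum ℂ fun a : A => (creation π E (a • ξ) : G →ₗ[ℂ] InteriorTensor π E)

lemma stinespringMap_single (π : B →⋆ₐ[ℂ] (G →L[ℂ] G)) (ξ : E) (a : A) (g : G) :
    stinespringMap A π ξ (Finsupp.single a g) = interiorTmul π (a • ξ) g :=
  (Finsupp.lsum_single _ _ _ _).trans (creation_apply π (a • ξ) g)

lemma range_stinespringMap_le (π : B →⋆ₐ[ℂ] (G →L[ℂ] G)) (ξ : E) :
    LinearMap.range (stinespringMap A π ξ) ≤
      Submodule.span ℂ (interiorTmulSet π fun a : A => a • ξ) := by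
  rintro _ ⟨v, rfl⟩
  induction v using Finsupp.induction_linear with
  | zero => simp
  | add v w hv hw => rw [map_add]; exact add_mem hv hw
  | single a g =>
    rw [stinespringMap_single]
    exact Submodule.subset_span ⟨a, g, rfl⟩

lemma IsGNSRepresentation.inner_stinespringMap (hE : IsHilbertBimodule A B E) {φ : A → B} {ξ : E}
    (hφ : IsGNSRepresentation φ ξ) (π : B →⋆ₐ[ℂ] (G →L[ℂ] G)) (v w : A →₀ G) :
    ⟪stinespringMap A π ξ v, stinespringMap A π ξ w⟫_ℂ = stinespringForm π φ v w := by
  induction v using Finsupp.induction_linear with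
  | zero => simp
  | add v v' hv hv' => simp [inner_add_left, hv, hv']
  | single a g =>
    induction w using Finsupp.induction_linear with
    | zero => simp
    | add w w' hw hw' => simp [inner_add_right, hw, hw']
    | single a' h =>
      rw [stinespringMap_single, stinespringMap_single, inner_interiorTmul,
        stinespringForm_single, hφ, mul_smul, hE.inner_smul]

lemma IsGNSRepresentation.stinespringForm_self (hE : IsHilbertBimodule A B E) {φ : A → B} {ξ : E}
    (hφ : IsGNSRepresentation φ ξ) (π : B →⋆ₐ[ℂ] (G →L[ℂ] G)) (v : A →₀ G) :
    stinespringForm π φ v v = (‖stinespringMap A π ξ v‖ ^ 2 : ℝ) := by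
  rw [← hφ.inner_stinespringMap hE, inner_self_eq_norm_sq_to_K]
  push_cast
  rfl

end StinespringMap

/-! ### Minimality and uniqueness. -/

section Minimal

variable {A G E F : Type*} [CStarAlgebra A] [NormedAddCommGroup G] [InnerProductSpace ℂ G]
  [CompleteSpace G] {B : VonNeumannAlgebra G}
  [NormedAddCommGroup E] [NormedSpace ℂ E] [Module Bᵐᵒᵖ E] [CStarModule Bᵐᵒᵖ E] [Module A E]
  [NormedAddCommGroup F] [NormedSpace ℂ F] [Module Bᵐᵒᵖ F] [CStarModule Bᵐᵒᵖ F] [Module A F]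

/-- In a minimal GNS-representation only `0` is orthogonal to `A ξ B`. -/
lemma IsMinimal.eq_zero {ξ : E} (hξ : IsMinimal A B ξ) {v : E}
    (hv : ∀ (a : A) (b : B), moduleInner B v (a • op b • ξ) = 0) : v = 0 := by
  have hspan : ∀ x ∈ Submodule.span ℂ {z : E | ∃ (a : A) (b : B), z = a • op b • ξ},
      moduleInner B v x = 0 := fun x hx => by
    induction hx using Submodule.span_induction with
    | zero => simp [moduleInner]
    | add x y _ _ hx hy => rw [moduleInner_add_right, hx, hy, add_zero]
    | smul c x _ hx => rw [moduleInner_smul_right, hx, smul_zero]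
    | mem x hx => obtain ⟨a, b, rfl⟩ := hx; exact hv a b
  have hclosed (g h : G) : IsClosed {X : G →Lₚₜ[ℂ] InteriorTensor B.inclusion E |
      ⟪interiorTmul B.inclusion v g, X h⟫_ℂ = 0} :=
    isClosed_eq (continuous_const.inner (continuous_eval_const h)) continuous_const
  have hzero (g h : G) : ⟪interiorTmul B.inclusion v g, interiorTmul B.inclusion v h⟫_ℂ = 0 := by
    -- Orthogonality to `v ⊙ g` at a fixed `h` is a strongly closed condition, so it passes from the
    -- span to `v` itself.
    refine closure_minimal ?_ (hclosed g h) (hξ ⟨v, trivial, rfl⟩)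
    rintro _ ⟨x, hx, rfl⟩
    change ⟪interiorTmul B.inclusion v g, interiorTmul B.inclusion x h⟫_ℂ = 0
    rw [inner_interiorTmul, hspan x hx]
    simp
  rw [← moduleInner_self (B := B)]
  refine B.inclusion_injective (ContinuousLinearMap.ext fun h => ext_inner_left ℂ fun g => ?_)
  rw [← inner_interiorTmul, hzero, map_zero]
  simp

/-- Bilinearity reduces all coefficients between generators to the given ones. Minimality of `E`
then identifies the adjoints on the generators of `F`, and minimality of `F` identifies the maps. -/
lemma IsMinimal.eq_of_moduleInner_eq {ξ : E} {η : F} (hE : IsHilbertBimodule A B E)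
    (hF : IsHilbertBimodule A B F) (hξ : IsMinimal A B ξ) (hη : IsMinimal A B η)
    {T T' : E →L[ℂ] F} (hT : IsAdjointableBilinearContraction A B T)
    (hT' : IsAdjointableBilinearContraction A B T')
    (h : ∀ a : A, moduleInner B η (T (a • ξ)) = moduleInner B η (T' (a • ξ))) : T = T' := by
  obtain ⟨S, hS⟩ := hT.adjointable
  obtain ⟨S', hS'⟩ := hT'.adjointable
  have hgen {T : E →L[ℂ] F} (hT : IsAdjointableBilinearContraction A B T) (a a' : A) (b b' : B) :
      moduleInner B (a' • op b' • η) (T (a • op b • ξ)) =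
        star b' * (moduleInner B η (T ((star a' * a) • ξ)) * b) := by
    rw [hE.smul_op_smul, hF.smul_op_smul, hT.map_right, moduleInner_op_smul_left,
      moduleInner_op_smul_right, hF.inner_smul, ← hT.map_left, mul_smul]
  have hSS (a' : A) (b' : B) : S (a' • op b' • η) = S' (a' • op b' • η) := by
    rw [← sub_eq_zero]
    refine hξ.eq_zero fun a b => ?_
    rw [← star_moduleInner, moduleInner_sub_right, ← hS, ← hS', star_sub, star_moduleInner,
      star_moduleInner, hgen hT, hgen hT', h, sub_self]
  refine ContinuousLinearMap.ext fun x => ?_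
  rw [← sub_eq_zero]
  refine hη.eq_zero fun a b => ?_
  rw [← star_moduleInner, moduleInner_sub_right, ← star_moduleInner (T x), hS, hSS, ← hS',
    star_moduleInner, sub_self, star_zero]

end Minimal

/-! ### The main theorem. -/

theorem theorem3p5
    {A : Type*} [CStarAlgebra A] [PartialOrder A] [StarOrderedRing A]
    {G : Type*} [NormedAddCommGroup G] [InnerProductSpace ℂ G] [CompleteSpace G]
    (B : VonNeumannAlgebra G)
    {F₁ : Type*} [NormedAddCommGroup F₁] [NormedSpace ℂ F₁] [Module Bᵐᵒᵖ F₁]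
    [CStarModule Bᵐᵒᵖ F₁] [Module A F₁]
    {F₂ : Type*} [NormedAddCommGroup F₂] [NormedSpace ℂ F₂] [Module Bᵐᵒᵖ F₂]
    [CStarModule Bᵐᵒᵖ F₂] [Module A F₂]
    (hF₁ : IsHilbertBimodule A B F₁) (hF₂ : IsHilbertBimodule A B F₂)
    (hvN₁ : IsVonNeumannModule B F₁) (hvN₂ : IsVonNeumannModule B F₂)
    (φ₁ φ₂ : A →CP B) (y₁ : F₁) (y₂ : F₂)
    (hy₁ : IsGNSRepresentation φ₁ y₁) (hy₂ : IsGNSRepresentation φ₂ y₂)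
    (ψ : A →ₗ[ℂ] B)
    (Φ : CStarMatrix (Fin 2) (Fin 2) A →CP CStarMatrix (Fin 2) (Fin 2) B)
    (hΦ : ∀ M : CStarMatrix (Fin 2) (Fin 2) A,
      Φ M = CStarMatrix.ofMatrix
        !![φ₁ (M 0 0), ψ (M 0 1); star (ψ (star (M 1 0))), φ₂ (M 1 1)]) :
    (∃ T : F₂ →L[ℂ] F₁, IsAdjointableBilinearContraction A B T ∧
      ∀ a : A, ψ a = moduleInner B y₁ (T (a • y₂))) ∧
    (IsMinimal A B y₁ → IsMinimal A B y₂ →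
      ∃! T : F₂ →L[ℂ] F₁, IsAdjointableBilinearContraction A B T ∧
        ∀ a : A, ψ a = moduleInner B y₁ (T (a • y₂))) := by
  have hexists : ∃ T : F₂ →L[ℂ] F₁, IsAdjointableBilinearContraction A B T ∧
      ∀ a : A, ψ a = moduleInner B y₁ (T (a • y₂)) := by
    obtain ⟨T, hTn, hTS, hT, hT'⟩ := exists_contraction_of_norm_le
      (stinespringMap A B.inclusion y₁) (stinespringMap A B.inclusion y₂)
      (stinespringForm B.inclusion ψ) fun v w =>
        norm_stinespringForm_le B.inclusion Φ hΦ v w (norm_nonneg _) (norm_nonneg _)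
          (hy₁.stinespringForm_self hF₁ B.inclusion v) (hy₂.stinespringForm_self hF₂ B.inclusion w)
    replace hT := fun z hz =>
      hT z (Submodule.orthogonal_le (range_stinespringMap_le B.inclusion y₂) hz)
    replace hT' := fun z hz =>
      hT' z (Submodule.orthogonal_le (range_stinespringMap_le B.inclusion y₁) hz)
    have hθ (a a' : A) (g h : G) : ⟪interiorTmul B.inclusion (a • y₁) g,
        T (interiorTmul B.inclusion (a' • y₂) h)⟫_ℂ =
        ⟪g, B.inclusion (ψ (star a * a')) h⟫_ℂ := by
      rw [← stinespringMap_single, ← stinespringMap_single, hTS, stinespringForm_single]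
    obtain ⟨t, t', htn, htT, hadj⟩ := hvN₁.exists_adjointable hvN₂ hTn hT hT' hθ
    have hinj := creation_injective (E := F₁) B.inclusion_injective
    refine ⟨t, ⟨⟨t', hadj⟩, fun a x => ?_, fun b x => ?_, htn⟩, fun a => ?_⟩
    · obtain ⟨α₁, hα₁, hα₁'⟩ := hF₁.exists_leftAction B.inclusion a
      obtain ⟨α₂, hα₂, hα₂'⟩ := hF₂.exists_leftAction B.inclusion a
      -- Weak intertwining on generators is the identity `c⋆(a c') = (a⋆c)⋆c'` inside `ψ`.
      have hcomm := comp_eq_comp_of_inner_eq hT hT' (c₁ := α₁) (c₂ := α₂)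
        (fun x y => (ContinuousLinearMap.adjoint_inner_left α₁ y x).symm)
        (fun x y => (ContinuousLinearMap.adjoint_inner_left α₂ y x).symm)
        (by
          rintro _ ⟨c, g, rfl⟩
          rw [hα₁, ← mul_smul]
          exact Submodule.le_topologicalClosure _ (Submodule.subset_span ⟨_, g, rfl⟩))
        (by
          rintro _ ⟨c, g, rfl⟩
          rw [hα₂', ← mul_smul]
          exact Submodule.le_topologicalClosure _ (Submodule.subset_span ⟨_, g, rfl⟩))
        (by
          rintro _ ⟨c, g, rfl⟩ _ ⟨c', h, rfl⟩
          rw [hα₁', hα₂, ← mul_smul, ← mul_smul, hθ, hθ, star_mul, star_star, mul_assoc])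
      refine hinj (ContinuousLinearMap.ext fun g => ?_)
      rw [creation_apply, creation_apply, htT, ← hα₂, hcomm, ← htT, hα₁]
    -- Right linearity is a consequence of adjointability alone.
    · refine ext_moduleInner B fun z => ?_
      rw [← star_moduleInner, hadj, star_moduleInner, moduleInner_op_smul_right,
        moduleInner_op_smul_right, ← star_moduleInner, ← hadj, star_moduleInner]
    · refine B.inclusion_injective (ContinuousLinearMap.ext fun h => ext_inner_left ℂ fun g => ?_)
      rw [← inner_interiorTmul, htT]
      simpa using (hθ 1 a g h).symm
  refine ⟨hexists, fun hmin₁ hmin₂ => ?_⟩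
  obtain ⟨T, hT, hψ⟩ := hexists
  exact ⟨T, ⟨hT, hψ⟩, fun T' ⟨hT', hψ'⟩ =>
    hmin₂.eq_of_moduleInner_eq hF₂ hF₁ hmin₁ hT' hT fun a => by rw [← hψ', ← hψ]⟩
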